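/- Let $n\ge 1$ and let $K,L\subset\mathbb{R}^n$ be convex bodies, i.e. compact convex sets with non-empty interior. Write $|\cdot|$ for Lebesgue measure, let $M(K,L)=\sup_{x\in K+L}|K\cap(x-L)|$, and for $\theta\in[0,1]$ let $$K+_\theta L=\{x\in K+L:\ |K\cap(x-L)|\ge\theta\,M(K,L)\}.$$ Then the following conditions are equivalent. (i) For all $\theta_1,\theta_2,\lambda_1,\lambda_2\in[0,1]$ with $\lambda_1+\lambda_2=1$, $$\lambda_1(K+_{\theta_1}L)+\lambda_2(K+_{\theta_2}L)=K+_\theta L,$$ where $\theta\in[0,1]$ is determined by $\theta^{1/n}=\lambda_1\theta_1^{1/n}+\lambda_2\theta_2^{1/n}$. (ii) For all $\theta\in[0,1]$, $$\theta^{1/n}(K+_1L)+(1-\theta^{1/n})(K+L)=K+_\theta L.$$ (iii) $K$ and $-L$ are homothetic $n$-simplices, i.e. each of them is the convex hull of $n+1$ affinely independent points, and $-L=z+\lambda K$ for some $z\in\mathbb{R}^n$ and $\lambda>0$. -/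

import Mathlib

open scoped Pointwise

/-- `M(A, B)`, the supremum over `x ∈ A + B` of the Lebesgue measure of `A ∩ (x - B)`. -/
noncomputable def maxOverlap {n : ℕ} (A B : Set (EuclideanSpace ℝ (Fin n))) : ENNReal :=
  ⨆ x ∈ A + B, MeasureTheory.volume (A ∩ ({x} - B))

/-- The `θ`-convolution set of `A` and `B` (intended for `0 ≤ θ ≤ 1` and `M(A, B) < ∞`):
the points `x ∈ A + B` with `|A ∩ (x - B)| ≥ θ M(A, B)`. -/
def thetaConv {n : ℕ} (θ : ℝ) (A B : Set (EuclideanSpace ℝ (Fin n))) :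
    Set (EuclideanSpace ℝ (Fin n)) :=
  {x | x ∈ A + B ∧ ENNReal.ofReal θ * maxOverlap A B ≤ MeasureTheory.volume (A ∩ ({x} - B))}

/-- `A` is an `n`-simplex in `ℝⁿ`: the convex hull of `n + 1` affinely independent points. -/
def IsFullSimplex {n : ℕ} (A : Set (EuclideanSpace ℝ (Fin n))) : Prop :=
  ∃ s : Affine.Simplex ℝ (EuclideanSpace ℝ (Fin n)) n, A = convexHull ℝ (Set.range s.points)

/-- `A` and `B` are homothetic: `B = z + c A` for a point `z` and some `c > 0`. -/
def AreHomothetic {n : ℕ} (A B : Set (EuclideanSpace ℝ (Fin n))) : Prop :=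
  ∃ (z : EuclideanSpace ℝ (Fin n)) (c : ℝ), 0 < c ∧ B = {z} + c • A

/-! For simplices everything is explicit. If `-L = z + c K` with `K` a simplex, then `K ∩ (x - L)`
is cut out of `ℝⁿ` by lower bounds on barycentric coordinates, so when non-empty it is a homothetic
copy of `K`. Its ratio, `overlapRatio`, is a concave piecewise linear function of `x`, and the
`n`-th root of the volume is proportional to it. The convolution sets are superlevel sets of the
ratio, and `exists_combo_overlapRatio` shows that these interpolate linearly.

Conversely, assume (ii) and let `x` be the maximiser of the overlap farthest in direction `u`, with
`k`, `l` extreme in `K`, `L` in that direction. At `t x + (1 - t)(k + l)` the overlap contains the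
copy of the maximal overlap contracted towards `k` by `t`, while (ii), read off support functions,
bounds its volume by that of the copy. So the two coincide, and the maximal overlap is the
intersection of the cones of `K` at `k` and of `x - L` at `x - l`
(`hasConicalOverlaps_of_thetaConv`).

Now let `k` be a contact point of `K` with a largest inscribed ball. The ball makes the cone at `k`
a half-space, so `L ∩ (x - K)` is a cone truncated by a hyperplane. If neither `L ⊆ x - K` nor `x -
K ⊆ L`, a small translation into the cone gains volume to first order and loses only `o` of that,
contradicting maximality (`exists_translate_volume_lt`). Hence a translate of one body fits inside
the reflection of the other.

Say `L ⊆ x - K`; then every maximal overlap is all of `L`. The same analysis with the roles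
exchanged attaches an apex of `L` to each contact normal of `L`. Since `0` is a convex combination
of at most `n + 1` contact normals, the extreme points of `L` are among as many apexes and `L` is a
simplex. The opposite cones of `K` then force `K` to be homothetic to `-L`. -/

open MeasureTheory Filter Topology Set

/-! ### First variation of the volume of an intersection under translation. -/

section FirstVariation

variable {E : Type*} [NormedAddCommGroup E] [InnerProductSpace ℝ E] [FiniteDimensional ℝ E]
  [MeasurableSpace E] [BorelSpace E]

theorem volume_preimage_add_right_vec (S : Set E) (v : E) :
    volume {w | w + v ∈ S} = volume S :=
  measure_preimage_add_right volume v S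

/-- If every `w ∈ O` enters the convex set `P` inside `Q` along the segment `[w, w + d]`, then the
set of points of `Q` that enter `P` in one step of length `d / N` is not small. -/
theorem volume_le_nsmul_volume_entry {P Q : Set E} (hQ : Convex ℝ Q) {d : E} {N : ℕ} (hN : 0 < N) :
    volume {w | w ∈ Q ∧ w ∉ P ∧ w + d ∈ P ∩ Q} ≤
      N * volume {w | w ∈ Q ∧ w ∉ P ∧ w + (1 / (N : ℝ)) • d ∈ P} := by
  classical
  set G : Set E := {w | w ∈ Q ∧ w ∉ P ∧ w + (1 / (N : ℝ)) • d ∈ P} with hG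
  have hN' : (0 : ℝ) < N := by exact_mod_cast hN
  have hsub : {w | w ∈ Q ∧ w ∉ P ∧ w + d ∈ P ∩ Q} ⊆
      ⋃ j ∈ Finset.range N, {w | w + ((j : ℝ) / N) • d ∈ G} := by
    rintro w ⟨hwQ, hwP, hwd⟩
    have hex : ∃ j : ℕ, w + ((j : ℝ) / N) • d ∈ P := ⟨N, by
      rw [div_self hN'.ne', one_smul]; exact hwd.1⟩
    -- The first grid point of the segment inside `P`; its predecessor is still outside `P`, and in
    -- `Q` by convexity, hence in `G`.
    set j := Nat.find hex with hj
    have hjN : j ≤ N := Nat.find_min' hex (by rw [div_self hN'.ne', one_smul]; exact hwd.1)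
    have hj0 : j ≠ 0 := by
      intro h
      have := Nat.find_spec hex
      rw [← hj, h] at this
      simp at this
      exact hwP this
    obtain ⟨i, hi⟩ := Nat.exists_eq_succ_of_ne_zero hj0
    have hiN : i < N := by omega
    simp only [mem_iUnion, Finset.mem_range]
    refine ⟨i, hiN, ?_, ?_, ?_⟩
    · have h1 : (i : ℝ) / N ≤ 1 := by
        rw [div_le_one hN']; exact_mod_cast hiN.le
      have := hQ.add_smul_sub_mem hwQ hwd.2 ⟨by positivity, h1⟩
      simpa using this
    · exact Nat.find_min hex (by omega)
    · have := Nat.find_spec hex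
      rw [← hj, hi] at this
      rw [add_assoc, ← add_smul, ← add_div]
      simpa using this
  calc _ ≤ volume (⋃ j ∈ Finset.range N, {w | w + ((j : ℝ) / N) • d ∈ G}) := measure_mono hsub
    _ ≤ ∑ j ∈ Finset.range N, volume {w | w + ((j : ℝ) / N) • d ∈ G} :=
        measure_biUnion_finset_le _ _
    _ = N * volume G := by simp [volume_preimage_add_right_vec]

/-- The factor `N` is absorbed by stacking `N` disjoint translates of the exit set along `d`. These
stacks stay in a fixed compact set and their indicators tend to `0` almost everywhere: `hd` empties
them on lines meeting the interior of `P ∩ Q`, and the remaining points lie on the boundary of a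
convex cylinder. -/
theorem tendsto_mul_volume_exit {P Q : Set E} (hP : Convex ℝ P) (hQ : Convex ℝ Q)
    (hPc : IsCompact P) (hQc : IsCompact Q) (hint : (interior (P ∩ Q)).Nonempty) {d : E}
    (hd : ∀ y ∈ interior (P ∩ Q), ∀ᶠ N : ℕ in atTop, ∀ s : ℝ, y + s • d ∈ P ∩ Q →
      y + (s + 1 / (N : ℝ)) • d ∈ P) :
    Tendsto (fun N : ℕ => N * volume {w | w ∈ P ∩ Q ∧ w + (1 / (N : ℝ)) • d ∉ P}) atTop (𝓝 0) := by
  set Λ : ℕ → Set E := fun N => {w | w ∈ P ∩ Q ∧ w + (1 / (N : ℝ)) • d ∉ P} with hΛ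
  have hΛm : ∀ N, MeasurableSet (Λ N) := fun N =>
    (hPc.measurableSet.inter hQc.measurableSet).inter
      ((measurable_add_const _ hPc.measurableSet).compl)
  set T : ℕ → ℕ → Set E := fun N j => {y | y + (-((j : ℝ) / N)) • d ∈ Λ N} with hT
  have hTm : ∀ N j, MeasurableSet (T N j) := fun N j => measurable_add_const _ (hΛm N)
  set Y : ℕ → Set E := fun N => ⋃ j ∈ Finset.range N, T N j with hY
  have hYm : ∀ N, MeasurableSet (Y N) := fun N =>
    Finset.measurableSet_biUnion _ fun j _ => hTm N j
  have hdisj : ∀ N, (↑(Finset.range N) : Set ℕ).PairwiseDisjoint (T N) := by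
    intro N
    have key : ∀ i j : ℕ, i < j → j < N → Disjoint (T N i) (T N j) := by
      intro i j hij hjN
      rw [Set.disjoint_left]
      intro y hyi hyj
      have hN' : (0 : ℝ) < N := by exact_mod_cast (by omega : 0 < N)
      have h1 := hyj.1.1
      have h2 := hyi.1.1
      have h3 := hyj.2
      apply h3
      have hji : (0 : ℝ) < (j : ℝ) - i := by
        have : (i : ℝ) < j := by exact_mod_cast hij
        linarith
      have hji1 : (1 : ℝ) ≤ (j : ℝ) - i := by
        have : (i : ℝ) + 1 ≤ j := by exact_mod_cast hij
        linarith
      -- One step from the `j`-th point lands between two points of `P`, so that point cannot be an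
      -- exit point.
      have := hP.add_smul_sub_mem h1 h2 (t := 1 / ((j : ℝ) - i))
        ⟨by positivity, by rw [div_le_one hji]; exact hji1⟩
      convert this using 1
      have e : y + (-((i : ℝ) / N)) • d - (y + (-((j : ℝ) / N)) • d)
          = (((j : ℝ) - i) / N) • d := by module
      rw [e, smul_smul]
      congr 2
      field_simp
    intro i hi j hj hij
    simp only [Finset.coe_range, mem_Iio] at hi hj
    rcases lt_or_gt_of_ne hij with h | h
    · exact key i j h hj
    · exact (key j i h hi).symm
  have hvol : ∀ N, volume (Y N) = N * volume (Λ N) := by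
    intro N
    rw [hY]
    simp only
    rw [measure_biUnion_finset (hdisj N) fun j _ => hTm N j]
    simp [hT, volume_preimage_add_right_vec]
  have hYt : Tendsto (fun N => volume (Y N)) atTop (𝓝 (volume (∅ : Set E))) := by
    have hBc : IsCompact (P + (fun s : ℝ => s • d) '' Icc (0 : ℝ) 1) :=
      hPc.add (isCompact_Icc.image (by fun_prop))
    -- The union of all lines in direction `d` through the interior; being convex, it has a null
    -- frontier.
    set Z : Set E := interior (P ∩ Q) + (fun s : ℝ => s • d) '' univ with hZ
    have hZconv : Convex ℝ Z := (hP.inter hQ).interior.add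
      (convex_univ.linear_image (LinearMap.toSpanSingleton ℝ E d))
    refine tendsto_measure_of_ae_tendsto_indicator atTop MeasurableSet.empty hYm
      hBc.measurableSet hBc.measure_lt_top.ne (Eventually.of_forall ?_) ?_
    · intro N y hy
      simp only [hY, mem_iUnion, Finset.mem_range] at hy
      obtain ⟨j, hj, hy⟩ := hy
      refine ⟨_, hy.1.1, _, ⟨(j : ℝ) / N, ⟨by positivity, ?_⟩, rfl⟩, ?_⟩
      · apply div_le_one_of_le₀ _ (by positivity)
        exact_mod_cast hj.le
      · simp only; module
    · have hfr : volume (frontier Z) = 0 := hZconv.addHaar_frontier volume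
      have hfr' : ∀ᵐ y ∂(volume : Measure E), y ∉ frontier Z := measure_eq_zero_iff_ae_notMem.1 hfr
      filter_upwards [hfr'] with y hy
      by_cases hyZ : y ∈ Z
      · obtain ⟨y0, hy0, _, ⟨τ, -, rfl⟩, rfl⟩ := hyZ
        filter_upwards [hd y0 hy0] with N hN
        simp only [mem_empty_iff_false, iff_false, hY, mem_iUnion, not_exists]
        rintro j hj ⟨h1, h2⟩
        apply h2
        have e : y0 + (fun s : ℝ => s • d) τ + (-((j : ℝ) / N)) • d
            = y0 + (τ - (j : ℝ) / N) • d := by simp only; module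
        rw [e] at h1 ⊢
        rw [add_assoc, ← add_smul]
        exact hN _ h1
      · refine Eventually.of_forall fun N => ?_
        simp only [mem_empty_iff_false, iff_false, hY, mem_iUnion, not_exists]
        rintro j hj ⟨h1, h2⟩
        apply hy
        refine ⟨?_, fun h => hyZ (interior_subset h)⟩
        have hcl : y + (-((j : ℝ) / N)) • d ∈ closure (interior (P ∩ Q)) := by
          rw [(hP.inter hQ).closure_interior_eq_closure_of_nonempty_interior hint]
          exact subset_closure h1
        have hm : MapsTo (fun z => z + ((j : ℝ) / N) • d) (interior (P ∩ Q)) Z :=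
          fun z hz => ⟨z, hz, _, ⟨_, mem_univ _, rfl⟩, rfl⟩
        have hc : Continuous fun z => z + ((j : ℝ) / N) • d := by fun_prop
        have := map_mem_closure hc hcl hm
        rwa [add_assoc, ← add_smul, neg_add_cancel, zero_smul, add_zero] at this
  rw [measure_empty] at hYt
  simpa only [hvol] using hYt

/-- Entry costs at least a constant over `N`, exit is `o(1/N)`, so the step `d / N` increases the
volume for some `N`. -/
theorem exists_volume_lt_of_entry {P Q : Set E} (hP : Convex ℝ P) (hQ : Convex ℝ Q)
    (hPc : IsCompact P) (hQc : IsCompact Q) (hint : (interior (P ∩ Q)).Nonempty) {d : E}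
    (hd : ∀ y ∈ interior (P ∩ Q), ∀ᶠ N : ℕ in atTop, ∀ s : ℝ, y + s • d ∈ P ∩ Q →
      y + (s + 1 / (N : ℝ)) • d ∈ P)
    (hO : 0 < volume {w | w ∈ Q ∧ w ∉ P ∧ w + d ∈ P ∩ Q}) :
    ∃ b : E, volume (P ∩ Q) < volume {w | w + b ∈ P ∧ w ∈ Q} := by
  have h1 := (tendsto_mul_volume_exit hP hQ hPc hQc hint hd).eventually (gt_mem_nhds hO)
  obtain ⟨N, hN, hN0⟩ := (h1.and (eventually_gt_atTop 0)).exists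
  have h2 := volume_le_nsmul_volume_entry (P := P) hQ (d := d) hN0
  set b := (1 / (N : ℝ)) • d with hb
  set Λ : Set E := {w | w ∈ P ∩ Q ∧ w + b ∉ P} with hΛ
  set G : Set E := {w | w ∈ Q ∧ w ∉ P ∧ w + b ∈ P} with hG
  have hlt : volume Λ < volume G := by
    have := hN.trans_le h2
    by_contra hcon
    exact absurd this (not_lt.2 (mul_le_mul' le_rfl (not_lt.1 hcon)))
  have hmb : MeasurableSet {w : E | w + b ∈ P} := measurable_add_const _ hPc.measurableSet
  have hPm := hPc.measurableSet
  have hQm := hQc.measurableSet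
  refine ⟨b, ?_⟩
  set R : Set E := {w | w ∈ P ∩ Q ∧ w + b ∈ P} with hR
  have hRm : MeasurableSet R := (hPm.inter hQm).inter hmb
  have hGm : MeasurableSet G := hQm.inter (hPm.compl.inter hmb)
  have e1 : P ∩ Q = R ∪ Λ := by
    ext w; simp only [hR, hΛ, mem_union, mem_ofPred_eq]; tauto
  have e2 : {w | w + b ∈ P ∧ w ∈ Q} = R ∪ G := by
    ext w; simp only [hR, hG, mem_union, mem_ofPred_eq, mem_inter_iff]; tauto
  have hd2 : Disjoint R G := by
    rw [Set.disjoint_left]; rintro w h1 h2; exact h2.2.1 h1.1.1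
  have hfin : volume R ≠ ⊤ :=
    ((measure_mono fun w (hw : w ∈ R) => hw.1.1).trans_lt hPc.measure_lt_top).ne
  rw [e2, measure_union hd2 hGm]
  calc volume (P ∩ Q) ≤ volume R + volume Λ := by rw [e1]; exact measure_union_le _ _
    _ < volume R + volume G := ENNReal.add_lt_add_left hfin hlt

end FirstVariation

/-! ### Cones at a point of a convex set, and the volume-increasing translation. -/

/-- The cone with apex `0` spanned by `P`, for `P` convex with `0 ∈ P`. -/
def apexCone {E : Type*} [AddCommGroup E] [Module ℝ E] (P : Set E) : Set E :=
  {w | ∃ t ∈ Ioc (0 : ℝ) 1, t • w ∈ P}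

section ApexCone

variable {E : Type*} [NormedAddCommGroup E] [NormedSpace ℝ E] {P Q : Set E}

theorem subset_apexCone : P ⊆ apexCone P := fun w hw => ⟨1, by simp, by simpa using hw⟩

theorem apexCone_anti_smul (hP : Convex ℝ P) (h0 : (0 : E) ∈ P) {w : E} {s t : ℝ} (hs : 0 ≤ s)
    (hst : s ≤ t) (hw : t • w ∈ P) : s • w ∈ P := by
  rcases eq_or_lt_of_le (hs.trans hst) with h | h
  · rw [show s = 0 by linarith, zero_smul]; exact h0
  · have := hP.smul_mem_of_zero_mem h0 hw (t := s / t) ⟨by positivity, by rwa [div_le_one h]⟩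
    rwa [smul_smul, div_mul_cancel₀ _ h.ne'] at this

theorem smul_mem_apexCone (hP : Convex ℝ P) (h0 : (0 : E) ∈ P) {w : E} (hw : w ∈ apexCone P)
    {s : ℝ} (hs : 0 < s) : s • w ∈ apexCone P := by
  obtain ⟨t, ht, hw⟩ := hw
  have htp := ht.1
  refine ⟨min 1 (t / s), ⟨by positivity, min_le_left _ _⟩, ?_⟩
  rw [smul_smul]
  refine apexCone_anti_smul hP h0 (by positivity) ?_ hw
  calc min 1 (t / s) * s ≤ t / s * s := by gcongr; exact min_le_right _ _
    _ = t := by field_simp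

theorem convex_apexCone (hP : Convex ℝ P) (h0 : (0 : E) ∈ P) : Convex ℝ (apexCone P) := by
  rintro x ⟨s, hs, hx⟩ y ⟨t, ht, hy⟩ a b ha hb hab
  have hs0 := hs.1
  have ht0 := ht.1
  refine ⟨min s t, ⟨by positivity, (min_le_left _ _).trans hs.2⟩, ?_⟩
  have h1 := apexCone_anti_smul hP h0 (by positivity) (min_le_left s t) hx
  have h2 := apexCone_anti_smul hP h0 (by positivity) (min_le_right s t) hy
  have := hP h1 h2 ha hb hab
  rwa [smul_comm a, smul_comm b, ← smul_add] at this

theorem smul_mem_interior_apexCone (hP : Convex ℝ P) (h0 : (0 : E) ∈ P) {w : E}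
    (hw : w ∈ interior (apexCone P)) {s : ℝ} (hs : 0 < s) : s • w ∈ interior (apexCone P) := by
  have h : s • interior (apexCone P) ⊆ apexCone P := by
    rintro _ ⟨v, hv, rfl⟩
    exact smul_mem_apexCone hP h0 (interior_subset hv) hs
  exact interior_maximal h (isOpen_interior.smul₀ hs.ne') ⟨w, hw, rfl⟩

theorem add_mem_interior_apexCone (hP : Convex ℝ P) (h0 : (0 : E) ∈ P) {v w : E}
    (hv : v ∈ apexCone P) (hw : w ∈ interior (apexCone P)) : v + w ∈ interior (apexCone P) := by
  have hc := (convex_apexCone hP h0).combo_self_interior_mem_interior hv hw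
    (a := 1 / 2) (b := 1 / 2) (by norm_num) (by norm_num) (by norm_num)
  have := smul_mem_interior_apexCone hP h0 hc (s := 2) (by norm_num)
  convert this using 1
  module

end ApexCone

section

variable {E : Type*} [NormedAddCommGroup E] [InnerProductSpace ℝ E] [FiniteDimensional ℝ E]
  [MeasurableSpace E] [BorelSpace E]

/-- If `P ∩ Q` is the cone spanned by `P` truncated at `φ ≤ 1`, while `P` exceeds the truncation
and `Q ⊆ {φ ≤ 1}` exceeds the cone, then some translate of `P` overlaps more with `Q`. -/
theorem exists_translate_volume_lt {P Q : Set E} (hP : Convex ℝ P) (hQ : Convex ℝ Q)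
    (hPc : IsCompact P) (hQc : IsCompact Q) (φ : E →L[ℝ] ℝ) (h0 : (0 : E) ∈ P)
    (hcap : ∀ w ∈ apexCone P, φ w ≤ 1 → w ∈ P ∩ Q) (hQφ : ∀ w ∈ Q, φ w ≤ 1)
    (hint : (interior (P ∩ Q)).Nonempty) {p : E} (hp : p ∈ P) (hφp : 1 < φ p) {q : E}
    (hq : q ∈ Q) (hqP : q ∉ P) :
    ∃ b : E, volume (P ∩ Q) < volume {w | w + b ∈ P ∧ w ∈ Q} := by
  obtain ⟨o, ho⟩ := hint
  have hoP : o ∈ interior P := interior_mono inter_subset_left ho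
  have hoQ : o ∈ interior Q := interior_mono inter_subset_right ho
  set Γ := apexCone P with hΓ
  have hPΓ : interior P ⊆ interior Γ := interior_mono subset_apexCone
  have hNlt : ∀ w ∈ interior Γ, φ w < 1 → w ∈ interior (P ∩ Q) := by
    intro w hw hφ
    have hopen : IsOpen (interior Γ ∩ {w | φ w < 1}) :=
      isOpen_interior.inter (isOpen_lt φ.continuous continuous_const)
    exact interior_maximal (fun v hv => hcap v (interior_subset hv.1) hv.2.le) hopen ⟨hw, hφ⟩
  have hltN : ∀ w ∈ interior (P ∩ Q), φ w < 1 := by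
    intro w hw
    have hc : Tendsto (fun ε : ℝ => w + ε • p) (𝓝[>] 0) (𝓝 w) := by
      have : Tendsto (fun ε : ℝ => w + ε • p) (𝓝 0) (𝓝 (w + (0 : ℝ) • p)) :=
        Continuous.tendsto (by fun_prop) _
      rw [zero_smul, add_zero] at this
      exact this.mono_left nhdsWithin_le_nhds
    obtain ⟨ε, hε, hε0⟩ := ((hc.eventually (isOpen_interior.mem_nhds hw)).and
      self_mem_nhdsWithin).exists
    have := hQφ _ (interior_subset hε).2
    rw [map_add, map_smul, smul_eq_mul] at this
    have : 0 < ε * φ p := mul_pos hε0 (by linarith)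
    linarith
  -- a point of the interior of `P` beyond the truncation
  obtain ⟨p', hp', hφp'⟩ : ∃ p' ∈ interior P, 1 < φ p' := by
    have hc : Tendsto (fun s : ℝ => p + s • (o - p)) (𝓝[>] 0) (𝓝 p) := by
      have : Tendsto (fun s : ℝ => p + s • (o - p)) (𝓝 0) (𝓝 (p + (0 : ℝ) • (o - p))) :=
        Continuous.tendsto (by fun_prop) _
      rw [zero_smul, add_zero] at this
      exact this.mono_left nhdsWithin_le_nhds
    have h1 := hc.eventually ((isOpen_lt continuous_const φ.continuous).mem_nhds hφp)
    have h2 : ∀ᶠ s : ℝ in 𝓝[>] 0, s < 1 := nhdsWithin_le_nhds (gt_mem_nhds one_pos)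
    obtain ⟨s, ⟨hs1, hs2⟩, hs0⟩ := ((h1.and h2).and self_mem_nhdsWithin).exists
    exact ⟨_, hP.add_smul_sub_mem_interior hp hoP ⟨hs0, hs2.le⟩, hs1⟩
  -- Interior to the cone, so moving along `b` never leaves the cone; the normalisation `φ b = 1`
  -- makes `φ` measure the displacement.
  set b := (φ p')⁻¹ • p' with hb
  have hφp0 : 0 < φ p' := by linarith
  have hφb : φ b = 1 := by rw [hb, map_smul, smul_eq_mul, inv_mul_cancel₀ hφp0.ne']
  have hbΓ : b ∈ interior Γ := smul_mem_interior_apexCone hP h0 (hPΓ hp') (inv_pos.2 hφp0)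
  -- the exit condition
  have hexit : ∀ σ : ℝ, 0 < σ → ∀ y ∈ interior (P ∩ Q), ∀ᶠ N : ℕ in atTop, ∀ s : ℝ,
      y + s • (σ • b) ∈ P ∩ Q → y + (s + 1 / (N : ℝ)) • (σ • b) ∈ P := by
    intro σ hσ y hy
    have hyφ := hltN y hy
    have hyP : y ∈ interior P := interior_mono inter_subset_left hy
    -- The parameter at which the line from `y` meets the hyperplane `φ = 1`.
    set τ := (1 - φ y) / σ with hτ
    have hτ0 : 0 < τ := div_pos (by linarith) hσ
    set w₁ := y + τ • (σ • b) with hw₁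
    have hφw₁ : φ w₁ = 1 := by
      rw [hw₁, map_add, map_smul, map_smul, hφb, smul_eq_mul, smul_eq_mul, hτ]
      field_simp; ring
    have hw₁Γ : w₁ ∈ interior Γ := by
      apply add_mem_interior_apexCone hP h0 (interior_subset (hPΓ hyP))
      exact smul_mem_interior_apexCone hP h0 (smul_mem_interior_apexCone hP h0 hbΓ hσ) hτ0
    -- `w₁` lies strictly between `p'` and a point of the truncated cone just below the hyperplane,
    -- both interior to `P`. Hence the line leaves `Q` while still inside `P`, and for large `N` one
    -- further step remains in `P`.
    have hw₁P : w₁ ∈ interior P := by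
      have hc : Tendsto (fun κ : ℝ => w₁ - κ • (p' - w₁)) (𝓝[>] 0) (𝓝 w₁) := by
        have : Tendsto (fun κ : ℝ => w₁ - κ • (p' - w₁)) (𝓝 0) (𝓝 (w₁ - (0 : ℝ) • (p' - w₁))) :=
          Continuous.tendsto (by fun_prop) _
        rw [zero_smul, sub_zero] at this
        exact this.mono_left nhdsWithin_le_nhds
      obtain ⟨κ, hκ, hκ0⟩ := ((hc.eventually (isOpen_interior.mem_nhds hw₁Γ)).and
        self_mem_nhdsWithin).exists
      have hκ0' : (0 : ℝ) < κ := hκ0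
      have h2 : w₁ - κ • (p' - w₁) ∈ interior (P ∩ Q) := by
        apply hNlt _ hκ
        rw [map_sub, map_smul, map_sub, hφw₁, smul_eq_mul]
        nlinarith
      have h3 := hP.interior.add_smul_sub_mem (interior_mono inter_subset_left h2) hp'
        (t := κ / (1 + κ)) ⟨by positivity, by rw [div_le_one (by positivity)]; linarith⟩
      convert h3 using 1
      have e : p' - (w₁ - κ • (p' - w₁)) = (1 + κ) • (p' - w₁) := by module
      rw [e, smul_smul, div_mul_cancel₀ _ (by positivity)]
      module
    have hc : Tendsto (fun N : ℕ => w₁ + (1 / (N : ℝ)) • (σ • b)) atTop (𝓝 w₁) := by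
      have : Tendsto (fun N : ℕ => w₁ + (1 / (N : ℝ)) • (σ • b)) atTop
          (𝓝 (w₁ + (0 : ℝ) • (σ • b))) :=
        tendsto_const_nhds.add (tendsto_one_div_atTop_nhds_zero_nat.smul_const _)
      simpa using this
    filter_upwards [hc.eventually (isOpen_interior.mem_nhds hw₁P), eventually_gt_atTop 0]
      with N hN hN0 s hs
    have hN' : (0 : ℝ) < N := by exact_mod_cast hN0
    have hsτ : s ≤ τ := by
      have := hQφ _ hs.2
      rw [map_add, map_smul, map_smul, hφb, smul_eq_mul, smul_eq_mul] at this
      rw [hτ, le_div_iff₀ hσ]; linarith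
    set r := τ + 1 / (N : ℝ) with hr
    have hend : y + r • (σ • b) ∈ P := by
      have := interior_subset hN
      rwa [hw₁, add_assoc, ← add_smul] at this
    have hδ : 0 < 1 / (N : ℝ) := by positivity
    have hrs : 0 < r - s := by linarith
    have := hP.add_smul_sub_mem hs.1 hend (t := (1 / (N : ℝ)) / (r - s))
      ⟨by positivity, by rw [div_le_one hrs]; linarith⟩
    convert this using 1
    have e : y + r • σ • b - (y + s • σ • b) = (r - s) • (σ • b) := by module
    rw [e, smul_smul _ (r - s), div_mul_cancel₀ _ hrs.ne']
    module
  -- a crossing point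
  set S : Set ℝ := Icc 0 1 ∩ {s | q + s • (o - q) ∈ P} with hS
  have hSc : IsCompact S := isCompact_Icc.inter_right
    (hPc.isClosed.preimage (by fun_prop : Continuous fun s : ℝ => q + s • (o - q)))
  have hSne : S.Nonempty := ⟨1, by simp, by
    simp only [mem_ofPred_eq, one_smul, add_sub_cancel]; exact interior_subset hoP⟩
  obtain ⟨s₀, hs₀, hleast⟩ := hSc.exists_isLeast hSne
  have hs₀0 : 0 < s₀ := by
    refine lt_of_le_of_ne hs₀.1.1 fun h => hqP ?_
    have := hs₀.2
    rw [← h] at this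
    simpa using this
  set c := q + s₀ • (o - q) with hc
  have hcP : c ∈ P := hs₀.2
  have hcQ : c ∈ interior Q := hQ.add_smul_sub_mem_interior hq hoQ ⟨hs₀0, hs₀.1.2⟩
  have hφc : φ c < 1 := by
    have h1 := hltN o ho
    have h2 := hQφ q hq
    rw [hc, map_add, map_smul, map_sub, smul_eq_mul]
    nlinarith [hs₀.1.2]
  -- Half the distance to the hyperplane, so that `c + σ b` is interior to the truncated cone.
  -- Points just before `c` on the segment from `q` are outside `P` and enter it under this shift.
  set σ := (1 - φ c) / 2 with hσ
  have hσ0 : 0 < σ := by rw [hσ]; linarith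
  have hcN : c + σ • b ∈ interior (P ∩ Q) := by
    apply hNlt
    · exact add_mem_interior_apexCone hP h0 (subset_apexCone hcP)
        (smul_mem_interior_apexCone hP h0 hbΓ hσ0)
    · rw [map_add, map_smul, hφb, smul_eq_mul, hσ]; linarith
  have hopen : IsOpen {w | w ∈ interior Q ∧ w + σ • b ∈ interior (P ∩ Q)} :=
    isOpen_interior.inter (isOpen_interior.preimage (by fun_prop))
  have htend : Tendsto (fun s : ℝ => q + s • (o - q)) (𝓝[<] s₀) (𝓝 c) :=
    (Continuous.tendsto (by fun_prop) s₀).mono_left nhdsWithin_le_nhds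
  have h1 : ∀ᶠ s : ℝ in 𝓝[<] s₀, 0 < s := nhdsWithin_le_nhds (lt_mem_nhds hs₀0)
  obtain ⟨s, hs1, hs0, hss⟩ := ((htend.eventually (hopen.mem_nhds ⟨hcQ, hcN⟩)).and
    (h1.and self_mem_nhdsWithin)).exists
  have hsP : q + s • (o - q) ∉ P := fun h =>
    absurd (hleast ⟨⟨hs0.le, (le_of_lt hss).trans hs₀.1.2⟩, h⟩) (not_le.2 hss)
  refine exists_volume_lt_of_entry hP hQ hPc hQc ⟨o, ho⟩ (hexit σ hσ0) ?_
  have hopen2 : IsOpen ({w | w ∈ interior Q ∧ w + σ • b ∈ interior (P ∩ Q)} ∩ Pᶜ) :=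
    hopen.inter hPc.isClosed.isOpen_compl
  refine (hopen2.measure_pos volume ⟨_, hs1, hsP⟩).trans_le (measure_mono ?_)
  rintro w ⟨⟨hw1, hw2⟩, hw3⟩
  exact ⟨interior_subset hw1, hw3, interior_subset hw2⟩

end

/-! ### Overlaps: convexity, symmetry, and semicontinuity of their volume. -/

/-- The points of `K` whose complement to `x` lies in `L`. -/
def overlap {E : Type*} [AddCommGroup E] (K L : Set E) (x : E) : Set E :=
  {y | y ∈ K ∧ x - y ∈ L}

theorem inter_singleton_sub {E : Type*} [AddCommGroup E] (K L : Set E) (x : E) :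
    K ∩ ({x} - L) = overlap K L x := by
  ext y
  simp only [overlap, mem_inter_iff, singleton_sub, mem_image, mem_ofPred_eq]
  refine and_congr_right fun _ => ⟨?_, fun h => ⟨_, h, by abel⟩⟩
  rintro ⟨l, hl, rfl⟩
  simpa using hl

section Overlap

variable {E : Type*} [NormedAddCommGroup E] {K L : Set E}

theorem isCompact_overlap (hK : IsCompact K) (hL : IsCompact L) (x : E) :
    IsCompact (overlap K L x) :=
  hK.inter_right (hL.isClosed.preimage (by fun_prop : Continuous fun y : E => x - y))

theorem mem_add_of_overlap_nonempty {x : E} (h : (overlap K L x).Nonempty) : x ∈ K + L := by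
  obtain ⟨y, hy, hy'⟩ := h
  exact ⟨y, hy, _, hy', by simp⟩

variable [InnerProductSpace ℝ E]

theorem convex_overlap (hK : Convex ℝ K) (hL : Convex ℝ L) (x : E) :
    Convex ℝ (overlap K L x) := by
  rintro y ⟨hy, hy'⟩ z ⟨hz, hz'⟩ a b ha hb hab
  refine ⟨hK hy hz ha hb hab, ?_⟩
  have := hL hy' hz' ha hb hab
  convert this using 1
  have : x = (a + b) • x := by rw [hab, one_smul]
  nth_rewrite 1 [this]
  module

variable [FiniteDimensional ℝ E] [MeasurableSpace E] [BorelSpace E]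

theorem volume_overlap_swap (K L : Set E) (x : E) :
    volume (overlap L K x) = volume (overlap K L x) := by
  have h : overlap L K x = Neg.neg ⁻¹' {y | y + x ∈ overlap K L x} := by
    ext y
    simp only [overlap, mem_ofPred_eq, mem_preimage, neg_add_eq_sub]
    rw [sub_sub_cancel, and_comm]
  rw [h, Measure.measure_preimage_neg, volume_preimage_add_right_vec]

theorem Convex.interior_nonempty_of_volume_pos {S : Set E} (hS : Convex ℝ S)
    (h : 0 < volume S) : (interior S).Nonempty := by
  by_contra hne
  rw [not_nonempty_iff_eq_empty] at hne
  have h1 : S ⊆ frontier S := by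
    rw [frontier, hne, sdiff_empty]; exact subset_closure
  exact absurd (measure_mono_null h1 (hS.addHaar_frontier volume)) h.ne'

/-- An interior point of `Q` missed by the closed set `P` would have a neighbourhood of positive
volume in `Q \ P`; the interior of `Q` is dense in `Q`. -/
theorem Convex.subset_of_volume_le {P Q : Set E} (hQ : Convex ℝ Q) (hP : IsClosed P)
    (hPQ : P ⊆ Q) (hpos : 0 < volume P) (hle : volume Q ≤ volume P) (hfin : volume P ≠ ⊤) :
    Q ⊆ P := by
  have hint := hQ.interior_nonempty_of_volume_pos (hpos.trans_le (measure_mono hPQ))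
  have hI : interior Q ⊆ P := by
    intro z hz
    by_contra hzP
    have ho : IsOpen (interior Q ∩ Pᶜ) := isOpen_interior.inter hP.isOpen_compl
    have hp := ho.measure_pos volume ⟨z, hz, hzP⟩
    have : volume P + volume (interior Q ∩ Pᶜ) ≤ volume Q := by
      rw [← measure_union _ ho.measurableSet]
      · exact measure_mono (union_subset hPQ (inter_subset_left.trans interior_subset))
      · exact disjoint_left.2 fun w hw hw' => hw'.2 hw
    exact absurd (this.trans hle) (not_le.2 (ENNReal.lt_add_right hfin hp.ne'))
  intro z hz
  have h1 : closure (interior Q) ⊆ P := closure_minimal hI hP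
  rw [hQ.closure_interior_eq_closure_of_nonempty_interior hint] at h1
  exact h1 (subset_closure hz)

/-- Overlaps at points near `x` lie in the overlap of `K` with a closed thickening of `L` at `x`,
and these decrease to the overlap at `x`. -/
theorem isClosed_le_volume_overlap (hK : IsCompact K) (hL : IsCompact L) (c : ENNReal) :
    IsClosed {x | c ≤ volume (overlap K L x)} := by
  apply IsSeqClosed.isClosed
  intro xs x hxs hx
  set D : ℕ → Set E := fun m => overlap K (Metric.cthickening (1 / ((m : ℝ) + 1)) L) x with hD
  have hDm : ∀ m, MeasurableSet (D m) := fun m => hK.measurableSet.inter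
    (Metric.isClosed_cthickening.preimage (by fun_prop : Continuous fun y : E => x - y)).measurableSet
  have hcD : ∀ m, c ≤ volume (D m) := by
    intro m
    obtain ⟨j, hj⟩ := (Metric.tendsto_nhds.1 hx (1 / ((m : ℝ) + 1)) (by positivity)).exists
    refine (hxs j).trans (measure_mono ?_)
    rintro y ⟨hy, hy'⟩
    refine ⟨hy, Metric.mem_cthickening_of_dist_le _ _ _ _ hy' ?_⟩
    rw [dist_sub_right, dist_comm]
    exact hj.le
  have hanti : Antitone D := by
    intro m m' hm y hy
    refine ⟨hy.1, Metric.cthickening_mono ?_ _ hy.2⟩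
    have : (m : ℝ) ≤ m' := by exact_mod_cast hm
    gcongr
  have hinter : ⋂ m, D m = overlap K L x := by
    ext y
    simp only [mem_iInter]
    constructor
    · intro h
      refine ⟨(h 0).1, ?_⟩
      rw [← hL.isClosed.closure_eq, Metric.closure_eq_iInter_cthickening]
      simp only [mem_iInter]
      intro δ hδ
      obtain ⟨m, hm⟩ := exists_nat_one_div_lt hδ
      exact Metric.cthickening_mono hm.le _ (h m).2
    · exact fun h m => ⟨h.1, Metric.self_subset_cthickening _ h.2⟩
  have ht := tendsto_measure_iInter_atTop (μ := (volume : Measure E))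
    (fun m => (hDm m).nullMeasurableSet) hanti
    ⟨0, ((measure_mono fun y hy => hy.1).trans_lt hK.measure_lt_top).ne⟩
  rw [hinter] at ht
  exact ge_of_tendsto' ht hcD

/-- `x` maximises the volume of the overlap. -/
def IsMaxOverlap (K L : Set E) (x : E) : Prop :=
  ∀ z, volume (overlap K L z) ≤ volume (overlap K L x)

/-- In every direction `u` there is a maximal overlap that coincides with the intersection of the
cones spanned by `K` and `x - L` at points extreme in directions `u` and `-u`. -/
def HasConicalOverlaps (K L : Set E) : Prop :=
  ∀ u : E, u ≠ 0 → ∃ x, IsMaxOverlap K L x ∧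
    ∀ k ∈ K, (∀ y ∈ K, inner ℝ y u ≤ inner ℝ k u) →
    ∀ l ∈ L, (∀ y ∈ L, inner ℝ y u ≤ inner ℝ l u) →
    ∀ p, ∀ t ∈ Ioc (0 : ℝ) 1, k + t • (p - k) ∈ K → l + t • (x - p - l) ∈ L →
      p ∈ K ∧ x - p ∈ L

theorem IsMaxOverlap.swap {x : E} (h : IsMaxOverlap K L x) : IsMaxOverlap L K x := by
  intro z
  rw [volume_overlap_swap K L z, volume_overlap_swap K L x]
  exact h z

theorem HasConicalOverlaps.swap (h : HasConicalOverlaps K L) : HasConicalOverlaps L K := by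
  intro u hu
  obtain ⟨x, hx, hc⟩ := h u hu
  refine ⟨x, hx.swap, fun l hl hl' k hk hk' p t ht hp1 hp2 => ?_⟩
  have := hc k hk hk' l hl hl' (x - p) t ht hp2 (by rwa [sub_sub_cancel])
  rw [sub_sub_cancel] at this
  exact this.symm

theorem exists_volume_overlap_pos (hK : (interior K).Nonempty) (hL : (interior L).Nonempty) :
    ∃ x, 0 < volume (overlap K L x) := by
  obtain ⟨k, hk⟩ := hK
  obtain ⟨l, hl⟩ := hL
  have ho : IsOpen (interior K ∩ {y | k + l - y ∈ interior L}) :=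
    isOpen_interior.inter (isOpen_interior.preimage (by fun_prop))
  refine ⟨k + l, (ho.measure_pos volume ⟨k, hk, ?_⟩).trans_le (measure_mono ?_)⟩
  · simpa using hl
  · rintro y ⟨h1, h2⟩
    exact ⟨interior_subset h1, interior_subset h2⟩

end Overlap

/-! ### From condition (ii) to conical maximal overlaps. -/

section ThetaConv

variable {n : ℕ} {K L : Set (EuclideanSpace ℝ (Fin n))}

theorem maxOverlap_eq_iSup (K L : Set (EuclideanSpace ℝ (Fin n))) :
    maxOverlap K L = ⨆ x, volume (overlap K L x) := by
  unfold maxOverlap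
  simp only [inter_singleton_sub]
  refine le_antisymm (iSup_mono fun x => iSup_le fun _ => le_rfl) (iSup_le fun x => ?_)
  by_cases hx : x ∈ K + L
  · exact le_iSup₂_of_le x hx le_rfl
  · have : overlap K L x = ∅ := by
      by_contra h
      exact hx (mem_add_of_overlap_nonempty (nonempty_iff_ne_empty.2 h))
    rw [this]; simp

theorem mem_thetaConv {θ : ℝ} {x : EuclideanSpace ℝ (Fin n)} :
    x ∈ thetaConv θ K L ↔
      x ∈ K + L ∧ ENNReal.ofReal θ * maxOverlap K L ≤ volume (overlap K L x) := by
  rw [← inter_singleton_sub]; rfl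

/-- This is the only use of (ii) in the converse: an upper volume bound at `xt` that matches the
lower bound from contracting the overlap at `x`. -/
theorem hasConicalOverlaps_of_thetaConv (hn : 1 ≤ n) (hKc : Convex ℝ K) (hLc : Convex ℝ L)
    (hK : IsCompact K) (hL : IsCompact L) (hKi : (interior K).Nonempty)
    (hLi : (interior L).Nonempty)
    (h : ∀ θ ∈ Icc (0 : ℝ) 1, θ ^ (1 / (n : ℝ)) • thetaConv 1 K L
      + (1 - θ ^ (1 / (n : ℝ))) • (K + L) = thetaConv θ K L) :
    HasConicalOverlaps K L := by
  have hn0 : n ≠ 0 := by omega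
  set V := maxOverlap K L with hV
  have hVle : ∀ x, volume (overlap K L x) ≤ V := fun x => by
    rw [hV, maxOverlap_eq_iSup]; exact le_iSup (fun x => volume (overlap K L x)) x
  have hVtop : V ≠ ⊤ := by
    rw [hV, maxOverlap_eq_iSup]
    exact ((iSup_le fun x => measure_mono fun y hy => hy.1).trans_lt hK.measure_lt_top).ne
  have hVpos : 0 < V := by
    obtain ⟨x, hx⟩ := exists_volume_overlap_pos hKi hLi
    exact hx.trans_le (hVle x)
  set A := thetaConv 1 K L with hA
  have hAmem : ∀ x, x ∈ A ↔ x ∈ K + L ∧ V ≤ volume (overlap K L x) := fun x => by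
    rw [hA, mem_thetaConv, ENNReal.ofReal_one, one_mul]
  have hAne : A.Nonempty := by
    -- At `θ = 0` the right-hand side is non-empty, so the summand `0 ^ (1 / n) • A` is non-empty,
    -- and therefore the maximum is attained.
    have h0 := h 0 (by simp)
    have hB : (thetaConv 0 K L).Nonempty := by
      obtain ⟨k, hk⟩ := hKi
      obtain ⟨l, hl⟩ := hLi
      exact ⟨k + l, mem_thetaConv.2 ⟨⟨k, interior_subset hk, l, interior_subset hl, rfl⟩, by simp⟩⟩
    rw [← h0] at hB
    exact smul_set_nonempty.1 hB.of_add_left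
  have hAc : IsCompact A := by
    have : A = (K + L) ∩ {x | V ≤ volume (overlap K L x)} := by ext x; exact hAmem x
    rw [this]
    exact (hK.add hL).inter_right (isClosed_le_volume_overlap hK hL V)
  intro u hu
  obtain ⟨x, hxA, hxmax⟩ := hAc.exists_isMaxOn hAne
    (f := fun y => inner ℝ y u) (by fun_prop)
  have hxV : volume (overlap K L x) = V := le_antisymm (hVle x) ((hAmem x).1 hxA).2
  refine ⟨x, fun z => (hVle z).trans hxV.ge, ?_⟩
  intro k hk hkmax l hl hlmax p t ht hpK hpL
  -- Strict because the overlap at `x` has interior; this makes the support value of `s A + (1 -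
  -- s)(K + L)` strictly decreasing in `s`.
  have hlt : inner ℝ x u < inner ℝ (k + l) u := by
    obtain ⟨y, hy⟩ := (convex_overlap hKc hLc x).interior_nonempty_of_volume_pos
      (hxV ▸ hVpos)
    have hc : Tendsto (fun ε : ℝ => y + ε • u) (𝓝[>] 0) (𝓝 y) := by
      have : Tendsto (fun ε : ℝ => y + ε • u) (𝓝 0) (𝓝 (y + (0 : ℝ) • u)) :=
        Continuous.tendsto (by fun_prop) _
      rw [zero_smul, add_zero] at this
      exact this.mono_left nhdsWithin_le_nhds
    obtain ⟨ε, hε, hε0⟩ := ((hc.eventually (isOpen_interior.mem_nhds hy)).and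
      self_mem_nhdsWithin).exists
    have h1 := hkmax _ (interior_subset hε).1
    have h2 := hlmax _ (interior_subset hy).2
    rw [inner_add_left, real_inner_smul_left] at h1
    rw [inner_sub_left] at h2
    rw [inner_add_left]
    have : 0 < ε * inner ℝ u u := mul_pos hε0 (real_inner_self_pos.2 hu)
    linarith
  rcases eq_or_lt_of_le ht.2 with ht1 | ht1
  · subst ht1
    simp only [one_smul, add_sub_cancel] at hpK hpL
    exact ⟨hpK, hpL⟩
  have ht0 := ht.1
  set xt := t • x + (1 - t) • (k + l) with hxt
  have hupper : volume (overlap K L xt) ≤ ENNReal.ofReal (t ^ n) * V := by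
    by_contra hcon
    rw [not_le] at hcon
    set θ := (volume (overlap K L xt) / V).toReal with hθ
    have hle1 : volume (overlap K L xt) / V ≤ 1 := ENNReal.div_le_of_le_mul (by
      rw [one_mul]; exact hVle xt)
    have hθV : ENNReal.ofReal θ * V = volume (overlap K L xt) := by
      rw [hθ, ENNReal.ofReal_toReal (hle1.trans_lt ENNReal.one_lt_top).ne,
        ENNReal.div_mul_cancel hVpos.ne' hVtop]
    have hθ1 : θ ≤ 1 := ENNReal.toReal_le_of_le_ofReal zero_le_one (by simpa using hle1)
    have hθt : t ^ n < θ := by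
      rw [← hθV] at hcon
      have := lt_of_mul_lt_mul_right' hcon
      exact (ENNReal.ofReal_lt_ofReal_iff_of_nonneg (by positivity)).1 this
    have hθ0 : 0 ≤ θ := (by positivity : (0 : ℝ) ≤ t ^ n).trans hθt.le
    have hmem : xt ∈ thetaConv θ K L := by
      refine mem_thetaConv.2 ⟨mem_add_of_overlap_nonempty ?_, hθV.le⟩
      exact nonempty_of_measure_ne_zero (ne_of_gt (lt_of_le_of_lt zero_le hcon))
    rw [← h θ ⟨hθ0, hθ1⟩] at hmem
    -- An overlap that is too large means `s > t`, so `xt` would be beyond the support value of `s A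
    -- + (1 - s)(K + L)` in direction `u`.
    set s := θ ^ (1 / (n : ℝ)) with hs
    have hst : t < s := by
      rw [hs, ← Real.pow_rpow_inv_natCast ht0.le hn0, one_div]
      exact Real.rpow_lt_rpow (by positivity) hθt (by positivity)
    have hs1 : s ≤ 1 := Real.rpow_le_one hθ0 hθ1 (by positivity)
    obtain ⟨_, ⟨a, ha, rfl⟩, _, ⟨b, ⟨k', hk', l', hl', rfl⟩, rfl⟩, hab⟩ := hmem
    have e1 : inner ℝ a u ≤ inner ℝ x u := hxmax ha
    have e2 : inner ℝ (k' + l') u ≤ inner ℝ (k + l) u := by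
      rw [inner_add_left, inner_add_left]; exact add_le_add (hkmax _ hk') (hlmax _ hl')
    have e3 := congrArg (fun z => inner ℝ z u) hab
    simp only at e3
    rw [hxt, inner_add_left, inner_add_left (t • x), real_inner_smul_left, real_inner_smul_left,
      real_inner_smul_left, real_inner_smul_left] at e3
    have e4 : s * inner ℝ a u ≤ s * inner ℝ x u := by gcongr
    have e5 : (1 - s) * inner ℝ (k' + l') u ≤ (1 - s) * inner ℝ (k + l) u := by gcongr
    nlinarith
  set D := AffineMap.homothety k t '' overlap K L x with hD
  have hDvol : volume D = ENNReal.ofReal (t ^ n) * V := by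
    rw [hD, Measure.addHaar_image_homothety, finrank_euclideanSpace_fin,
      abs_of_nonneg (by positivity), hxV]
  have hDcl : IsClosed D := ((isCompact_overlap hK hL x).image (by fun_prop)).isClosed
  have hDsub : D ⊆ overlap K L xt := by
    rintro _ ⟨y, ⟨hy, hy'⟩, rfl⟩
    refine ⟨?_, ?_⟩
    · rw [AffineMap.homothety_apply, vsub_eq_sub, vadd_eq_add, add_comm]
      exact hKc.add_smul_sub_mem hk hy ⟨ht0.le, ht.2⟩
    · have := hLc.add_smul_sub_mem hl hy' ⟨ht0.le, ht.2⟩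
      convert this using 1
      rw [AffineMap.homothety_apply, vsub_eq_sub, vadd_eq_add, hxt]
      module
  have hsub := (convex_overlap hKc hLc xt).subset_of_volume_le hDcl hDsub
    (by rw [hDvol]; exact ENNReal.mul_pos (by simpa using pow_pos ht0 n) hVpos.ne')
    (by rw [hDvol]; exact hupper)
    (by rw [hDvol]; exact ENNReal.mul_ne_top ENNReal.ofReal_ne_top hVtop)
  obtain ⟨y, hy, hyp⟩ := hsub (show k + t • (p - k) ∈ overlap K L xt from ⟨hpK, by
    convert hpL using 1; rw [hxt]; module⟩)
  rw [AffineMap.homothety_apply, vsub_eq_sub, vadd_eq_add, add_comm, add_right_inj] at hyp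
  have := smul_right_injective _ ht0.ne' hyp
  rw [sub_left_inj] at this
  exact this ▸ hy

end ThetaConv

/-! ### Largest inscribed balls and their contact normals. -/

/-- By Carathéodory, the hull is the continuous image of a standard simplex times a power of `s`;
short combinations are padded with zero weights at `z₀`. -/
theorem isCompact_convexHull_of_finiteDimensional {E : Type*} [NormedAddCommGroup E]
    [NormedSpace ℝ E] [FiniteDimensional ℝ E] {s : Set E} (hs : IsCompact s) :
    IsCompact (convexHull ℝ s) := by
  rcases s.eq_empty_or_nonempty with rfl | ⟨z₀, hz₀⟩
  · simp
  set d := Module.finrank ℝ E + 1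
  have hc : IsCompact (stdSimplex ℝ (Fin d) ×ˢ (univ.pi fun _ : Fin d => s)) :=
    (isCompact_stdSimplex ℝ (Fin d)).prod (isCompact_univ_pi fun _ => hs)
  have hf : Continuous fun p : (Fin d → ℝ) × (Fin d → E) => ∑ i, p.1 i • p.2 i := by fun_prop
  convert hc.image hf
  ext x
  constructor
  · intro hx
    obtain ⟨ι, _, z, w, hz, hz', hw, hw1, hx⟩ := eq_pos_convex_span_of_mem_convexHull hx
    have hcard : Fintype.card ι ≤ Fintype.card (Fin d) := by
      rw [Fintype.card_fin]
      exact hz'.card_le_finrank_succ.trans (Nat.succ_le_succ (Submodule.finrank_le _))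
    obtain ⟨e⟩ := Function.Embedding.nonempty_of_card_le hcard
    have hw' : ∀ i, i ∉ range e → Function.extend e w 0 i = 0 := fun i hi =>
      Function.extend_apply' _ _ _ hi
    refine ⟨⟨Function.extend e w 0, Function.extend e z fun _ => z₀⟩, ⟨⟨fun i => ?_, ?_⟩, ?_⟩, ?_⟩
    · by_cases hi : i ∈ range e
      · obtain ⟨j, rfl⟩ := hi
        simp only [e.injective.extend_apply]
        exact (hw j).le
      · simp only [hw' i hi, le_refl]
    · rw [← hw1]
      exact (Fintype.sum_of_injective e e.injective w _ hw'
        fun i => (e.injective.extend_apply _ _ _).symm).symm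
    · intro i _
      by_cases hi : i ∈ range e
      · obtain ⟨j, rfl⟩ := hi
        simp only [e.injective.extend_apply]
        exact hz ⟨j, rfl⟩
      · simp only [Function.extend_apply' _ _ _ hi]
        exact hz₀
    · rw [← hx]
      refine (Fintype.sum_of_injective e e.injective (fun i => w i • z i) _ ?_ ?_).symm
      · intro i hi
        simp only [hw' i hi, zero_smul]
      · intro i
        simp only [e.injective.extend_apply]
  · rintro ⟨⟨w, z⟩, ⟨⟨hw, hw1⟩, hz⟩, rfl⟩
    exact (convex_convexHull ℝ s).sum_mem (fun i _ => hw i) hw1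
      fun i _ => subset_convexHull ℝ s (hz i (mem_univ i))

section

variable {E : Type*} [NormedAddCommGroup E] [InnerProductSpace ℝ E]

/-- The unit outer normals of `K` at the points where the ball of centre `q` and radius `r`
touches the boundary of `K`. -/
def contactNormals (K : Set E) (q : E) (r : ℝ) : Set E :=
  {u | ‖u‖ = 1 ∧ ∀ y ∈ K, inner ℝ y u ≤ inner ℝ (q + r • u) u}

theorem isClosed_contactNormals (K : Set E) (q : E) (r : ℝ) :
    IsClosed (contactNormals K q r) := by
  have : contactNormals K q r =
      {u | ‖u‖ = 1} ∩ ⋂ y ∈ K, {u | inner ℝ y u ≤ inner ℝ (q + r • u) u} := by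
    ext u; simp [contactNormals]
  rw [this]
  refine (isClosed_eq continuous_norm continuous_const).inter ?_
  exact isClosed_biInter fun y _ => isClosed_le (by fun_prop) (by fun_prop)

/-- A hyperplane supporting `K` at `y` also supports the ball there; equality in Cauchy–Schwarz
aligns its normal with `y - q`. -/
theorem mem_contactNormals_of_mem_closure_compl [CompleteSpace E] {K : Set E} (hK : Convex ℝ K)
    (hint : (interior K).Nonempty) {q y : E} {r : ℝ} (hr : 0 < r)
    (hball : Metric.closedBall q r ⊆ K) (hy : y ∈ closure Kᶜ) (hyq : ‖y - q‖ = r) :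
    r⁻¹ • (y - q) ∈ contactNormals K q r := by
  rw [closure_compl] at hy
  obtain ⟨f, hf⟩ := geometric_hahn_banach_open_point hK.interior isOpen_interior hy
  set w := (InnerProductSpace.toDual ℝ E).symm f with hw
  have hfw : ∀ a, f a = inner ℝ w a := fun a => by
    rw [hw, InnerProductSpace.toDual_symm_apply]
  obtain ⟨o, ho⟩ := hint
  have hw0 : w ≠ 0 := by
    intro h0
    have := hf o ho
    rw [hfw, hfw, h0, inner_zero_left, inner_zero_left] at this
    exact lt_irrefl _ this
  have hwn : 0 < ‖w‖ := norm_pos_iff.2 hw0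
  have hle : ∀ a ∈ K, inner ℝ w a ≤ inner ℝ w y := by
    intro a ha
    have h1 : a ∈ closure (interior K) := by
      rw [hK.closure_interior_eq_closure_of_nonempty_interior ⟨o, ho⟩]; exact subset_closure ha
    have h2 : IsClosed {a | inner ℝ w a ≤ inner ℝ w y} :=
      isClosed_le (by fun_prop) (by fun_prop)
    refine closure_minimal (fun b hb => ?_) h2 h1
    have := hf b hb
    rw [hfw, hfw] at this
    exact this.le
  have h1 : q + (r / ‖w‖) • w ∈ K := by
    apply hball
    rw [mem_closedBall_iff_norm, add_sub_cancel_left, norm_smul, Real.norm_of_nonneg (by positivity),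
      div_mul_cancel₀ _ hwn.ne']
  have h2 := hle _ h1
  rw [inner_add_right, real_inner_smul_right, real_inner_self_eq_norm_sq] at h2
  have h3 : inner ℝ w (y - q) = ‖w‖ * ‖y - q‖ := by
    refine le_antisymm (real_inner_le_norm _ _) ?_
    rw [inner_sub_right, hyq]
    have : r / ‖w‖ * ‖w‖ ^ 2 = ‖w‖ * r := by field_simp
    linarith
  rw [inner_eq_norm_mul_iff_real, hyq] at h3
  have h4 : r⁻¹ • (y - q) = ‖w‖⁻¹ • w := by
    rw [inv_smul_eq_iff₀ hr.ne', smul_comm, h3, inv_smul_smul₀ hwn.ne']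
  refine ⟨by rw [norm_smul, hyq, norm_inv, Real.norm_of_nonneg hr.le, inv_mul_cancel₀ hr.ne'], ?_⟩
  intro a ha
  rw [smul_inv_smul₀ hr.ne', add_sub_cancel, h4, real_inner_smul_right, real_inner_smul_right,
    real_inner_comm w a, real_inner_comm w y]
  exact mul_le_mul_of_nonneg_left (hle a ha) (by positivity)

/-- The normals at the contact points of a largest inscribed ball contain `0` in their hull. -/
theorem exists_closedBall_subset_zero_mem_convexHull [FiniteDimensional ℝ E] [Nontrivial E]
    {K : Set E} (hK : Convex ℝ K) (hKc : IsCompact K) (hint : (interior K).Nonempty) :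
    ∃ q r, 0 < r ∧ Metric.closedBall q r ⊆ K ∧ (0 : E) ∈ convexHull ℝ (contactNormals K q r) := by
  have hne : (Kᶜ).Nonempty := by
    rw [nonempty_compl]
    rintro rfl
    exact noncompact_univ E hKc
  obtain ⟨q, hqK, hqmax⟩ := hKc.exists_isMaxOn (hint.mono interior_subset)
    (f := fun q => Metric.infDist q Kᶜ) (Metric.continuous_infDist_pt _).continuousOn
  set r := Metric.infDist q Kᶜ with hr
  have hr0 : 0 < r := by
    obtain ⟨o, ho⟩ := hint
    have h1 : o ∉ closure Kᶜ := by rw [closure_compl]; simpa using ho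
    rw [Metric.infDist_pos_iff_notMem_closure hne] at h1
    exact h1.trans_le (hqmax (interior_subset ho))
  have hball : Metric.closedBall q r ⊆ K := by
    rw [← closure_ball q hr0.ne']
    exact closure_minimal Metric.ball_infDist_compl_subset hKc.isClosed
  refine ⟨q, r, hr0, hball, ?_⟩
  -- Otherwise some `d` has negative inner product with every contact normal. Moving the centre
  -- slightly along `d` cannot increase its distance to the complement, and nearest complement
  -- points accumulate at a contact point whose normal has non-negative inner product with `d`.
  by_contra h0
  have hUc : IsCompact (contactNormals K q r) := by
    refine (isCompact_sphere (0 : E) 1).of_isClosed_subset (isClosed_contactNormals K q r) ?_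
    intro u hu
    simpa using hu.1
  obtain ⟨f, c, hf1, hf2⟩ := geometric_hahn_banach_closed_point (convex_convexHull ℝ _)
    (isCompact_convexHull_of_finiteDimensional hUc).isClosed h0
  rw [map_zero] at hf2
  set d := (InnerProductSpace.toDual ℝ E).symm f with hd
  have hfd : ∀ a, f a = inner ℝ a d := fun a => by
    rw [real_inner_comm, hd, InnerProductSpace.toDual_symm_apply]
  have hstep : ∀ m : ℕ, ∃ y ∈ closure Kᶜ, dist (q + (1 / ((m : ℝ) + 1)) • d) y ≤ r := by
    intro m
    obtain ⟨y, hy, hy'⟩ := (isClosed_closure (s := Kᶜ)).exists_infDist_eq_dist hne.closure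
      (q + (1 / ((m : ℝ) + 1)) • d)
    refine ⟨y, hy, ?_⟩
    rw [← hy', Metric.infDist_closure]
    by_cases hm : q + (1 / ((m : ℝ) + 1)) • d ∈ K
    · exact hqmax hm
    · rw [Metric.infDist_zero_of_mem hm]; exact hr0.le
  choose y hyc hyr using hstep
  have hge : ∀ z ∈ closure Kᶜ, r ≤ ‖z - q‖ := by
    intro z hz
    rw [hr, ← Metric.infDist_closure, ← dist_eq_norm, dist_comm]
    exact Metric.infDist_le_dist_of_mem hz
  have hinner : ∀ m, 0 ≤ inner ℝ (y m - q) d := by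
    intro m
    set ε : ℝ := 1 / ((m : ℝ) + 1) with hε
    have hε0 : 0 < ε := by positivity
    have h1 := hyr m
    rw [dist_comm, dist_eq_norm, ← sub_sub] at h1
    have h2 : ‖y m - q - ε • d‖ ^ 2 ≤ ‖y m - q‖ ^ 2 := by
      gcongr; exact h1.trans (hge _ (hyc m))
    rw [norm_sub_sq_real, real_inner_smul_right] at h2
    have h3 : 0 ≤ ‖ε • d‖ ^ 2 := by positivity
    have h4 : 0 ≤ ε * inner ℝ (y m - q) d := by linarith
    exact nonneg_of_mul_nonneg_right h4 hε0
  have hmem : ∀ m, y m ∈ Metric.closedBall q (r + ‖d‖) := by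
    intro m
    rw [Metric.mem_closedBall, dist_comm]
    refine (dist_triangle _ (q + (1 / ((m : ℝ) + 1)) • d) _).trans ?_
    rw [add_comm r]
    refine add_le_add ?_ (hyr m)
    rw [dist_self_add_right, norm_smul, Real.norm_of_nonneg (by positivity)]
    refine mul_le_of_le_one_left (norm_nonneg _) ?_
    rw [div_le_one (by positivity)]
    have : (0 : ℝ) ≤ m := by positivity
    linarith
  obtain ⟨z, -, σ, hσ, hz⟩ := (isCompact_closedBall q (r + ‖d‖)).tendsto_subseq hmem
  have hzc : z ∈ closure Kᶜ := isClosed_closure.mem_of_tendsto hz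
    (Eventually.of_forall fun m => hyc _)
  have hzd : 0 ≤ inner ℝ (z - q) d :=
    ge_of_tendsto' ((hz.sub_const q).inner tendsto_const_nhds) fun m => hinner (σ m)
  have hzr : ‖z - q‖ = r := by
    refine le_antisymm ?_ (hge z hzc)
    have h1 : Tendsto (fun m : ℕ => q + (1 / ((m : ℝ) + 1)) • d) atTop (𝓝 (q + (0 : ℝ) • d)) :=
      tendsto_const_nhds.add (tendsto_one_div_add_atTop_nhds_zero_nat.smul_const _)
    rw [zero_smul, add_zero] at h1
    rw [← dist_eq_norm, dist_comm]
    exact le_of_tendsto' ((h1.comp hσ.tendsto_atTop).dist hz) fun m => hyr (σ m)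
  have hU := mem_contactNormals_of_mem_closure_compl hK hint hr0 hball hzc hzr
  have h5 := hf1 _ (subset_convexHull ℝ _ hU)
  rw [hfd, real_inner_smul_left] at h5
  have : 0 ≤ r⁻¹ * inner ℝ (z - q) d := by positivity
  linarith

end

/-! ### Contact points produce truncated cones, hence an inclusion of the bodies. -/

section Cap

variable {E : Type*} [NormedAddCommGroup E] [InnerProductSpace ℝ E] [FiniteDimensional ℝ E]
  [MeasurableSpace E] [BorelSpace E] {K L : Set E}

/-- At a contact normal of `K`, the set `L` is a cone truncated by a hyperplane up to the
corresponding height. -/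
theorem truncated_cone_of_contact (hKc : Convex ℝ K) (hLc : Convex ℝ L) (hK : IsCompact K)
    (hL : IsCompact L) {q u x l : E} {r : ℝ} (hr : 0 < r) (hball : Metric.closedBall q r ⊆ K)
    (hu : u ∈ contactNormals K q r) (hpos : 0 < volume (overlap K L x)) (hl : l ∈ L)
    (hlmax : ∀ y ∈ L, inner ℝ y u ≤ inner ℝ l u)
    (hcon : ∀ p, ∀ t ∈ Ioc (0 : ℝ) 1, q + r • u + t • (p - (q + r • u)) ∈ K →
      l + t • (x - p - l) ∈ L → p ∈ K ∧ x - p ∈ L) :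
    inner ℝ (x - (q + r • u)) u < inner ℝ l u ∧
      ∀ w, ∀ t ∈ Ioc (0 : ℝ) 1, l + t • (w - l) ∈ L → inner ℝ (x - (q + r • u)) u ≤ inner ℝ w u →
        w ∈ L ∧ x - w ∈ K := by
  set k := q + r • u with hk
  have huu : inner ℝ u u = (1 : ℝ) := by rw [real_inner_self_eq_norm_sq, hu.1, one_pow]
  have hlt : inner ℝ (x - k) u < inner ℝ l u := by
    obtain ⟨y, hy⟩ := (convex_overlap hKc hLc x).interior_nonempty_of_volume_pos hpos
    have hc : Tendsto (fun ε : ℝ => y + ε • u) (𝓝[>] 0) (𝓝 y) := by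
      have : Tendsto (fun ε : ℝ => y + ε • u) (𝓝 0) (𝓝 (y + (0 : ℝ) • u)) :=
        Continuous.tendsto (by fun_prop) _
      rw [zero_smul, add_zero] at this
      exact this.mono_left nhdsWithin_le_nhds
    obtain ⟨ε, hε, hε0⟩ := ((hc.eventually (isOpen_interior.mem_nhds hy)).and
      self_mem_nhdsWithin).exists
    have hε0' : (0 : ℝ) < ε := hε0
    have h1 := hu.2 _ (interior_subset hε).1
    have h2 := hlmax _ (interior_subset hy).2
    rw [inner_add_left, real_inner_smul_left, huu] at h1
    rw [inner_sub_left] at h2 ⊢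
    linarith
  have hstrict : ∀ w, ∀ t ∈ Ioc (0 : ℝ) 1, l + t • (w - l) ∈ L →
      inner ℝ (x - k) u < inner ℝ w u → w ∈ L ∧ x - w ∈ K := by
    intro w t₁ ht₁ hw hwu
    set v := x - w - k with hv
    have hα : 0 < -inner ℝ v u := by
      rw [hv, inner_sub_left, inner_sub_left]; rw [inner_sub_left] at hwu; linarith
    -- Expanding `‖r u + t v‖² ≤ r²` shows that this smallness of `t` puts `k + t v` in the
    -- inscribed ball.
    have h1 : ∀ᶠ t : ℝ in 𝓝[>] 0, t * ‖v‖ ^ 2 < 2 * r * -inner ℝ v u := by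
      have : Tendsto (fun t : ℝ => t * ‖v‖ ^ 2) (𝓝 0) (𝓝 (0 * ‖v‖ ^ 2)) :=
        Continuous.tendsto (by fun_prop) _
      rw [zero_mul] at this
      exact nhdsWithin_le_nhds (this.eventually (gt_mem_nhds (by positivity)))
    have h2 : ∀ᶠ t : ℝ in 𝓝[>] 0, t < t₁ := nhdsWithin_le_nhds (gt_mem_nhds ht₁.1)
    obtain ⟨t, ⟨ht, htt⟩, ht0⟩ := ((h1.and h2).and self_mem_nhdsWithin).exists
    have ht0' : (0 : ℝ) < t := ht0
    have hkb : k + t • (x - w - k) ∈ K := by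
      apply hball
      rw [mem_closedBall_iff_norm, ← hv]
      refine le_of_sq_le_sq ?_ hr.le
      have e : k + t • v - q = r • u + t • v := by rw [hk]; module
      rw [e, norm_add_sq_real, norm_smul, norm_smul, hu.1, real_inner_smul_left,
        real_inner_smul_right, real_inner_comm, Real.norm_of_nonneg hr.le,
        Real.norm_of_nonneg ht0'.le]
      nlinarith
    have hlL : l + t • (x - (x - w) - l) ∈ L := by
      rw [sub_sub_cancel]
      have := hLc.add_smul_sub_mem hl hw (t := t / t₁)
        ⟨by have := ht₁.1; positivity, by rw [div_le_one ht₁.1]; exact htt.le⟩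
      rwa [add_sub_cancel_left, smul_smul, div_mul_cancel₀ _ ht₁.1.ne'] at this
    have := hcon (x - w) t ⟨ht0', htt.le.trans ht₁.2⟩ hkb hlL
    rw [sub_sub_cancel] at this
    exact this.symm
  refine ⟨hlt, fun w t ht hw hwu => ?_⟩
  -- Points on the truncating hyperplane are limits of points strictly above it, obtained by moving
  -- towards `l`.
  have hc : Tendsto (fun ε : ℝ => w + ε • (l - w)) (𝓝[>] 0) (𝓝 w) := by
    have : Tendsto (fun ε : ℝ => w + ε • (l - w)) (𝓝 0) (𝓝 (w + (0 : ℝ) • (l - w))) :=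
      Continuous.tendsto (by fun_prop) _
    rw [zero_smul, add_zero] at this
    exact this.mono_left nhdsWithin_le_nhds
  have h1 : ∀ᶠ ε : ℝ in 𝓝[>] 0, ε < 1 := nhdsWithin_le_nhds (gt_mem_nhds one_pos)
  have hev : ∀ᶠ ε : ℝ in 𝓝[>] 0, w + ε • (l - w) ∈ L ∧ x - (w + ε • (l - w)) ∈ K := by
    filter_upwards [h1, self_mem_nhdsWithin] with ε hε1 hε0
    have hε0' : (0 : ℝ) < ε := hε0
    refine hstrict _ t ht ?_ ?_
    · have := hLc.add_smul_sub_mem hl hw (t := 1 - ε) ⟨by linarith, by linarith⟩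
      convert this using 1
      module
    · rw [inner_add_left w, real_inner_smul_left, inner_sub_left l]
      nlinarith
  exact ⟨hL.isClosed.mem_of_tendsto hc (hev.mono fun _ h => h.1),
    hK.isClosed.mem_of_tendsto (tendsto_const_nhds.sub hc) (hev.mono fun _ h => h.2)⟩

theorem IsMaxOverlap.volume_pos {x : E} (h : IsMaxOverlap K L x) (hKi : (interior K).Nonempty)
    (hLi : (interior L).Nonempty) : 0 < volume (overlap K L x) := by
  obtain ⟨z, hz⟩ := exists_volume_overlap_pos hKi hLi
  exact hz.trans_le (h z)

/-- With `l` moved to the origin, `L` and `x - K` are the `P` and `Q` of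
`exists_translate_volume_lt`; failure of both inclusions would give a translate with larger overlap.
-/
theorem HasConicalOverlaps.exists_subset [Nontrivial E] (h : HasConicalOverlaps K L)
    (hKc : Convex ℝ K) (hLc : Convex ℝ L) (hK : IsCompact K) (hL : IsCompact L)
    (hKi : (interior K).Nonempty) (hLi : (interior L).Nonempty) :
    ∃ x, IsMaxOverlap K L x ∧ ((∀ w ∈ L, x - w ∈ K) ∨ ∀ y ∈ K, x - y ∈ L) := by
  obtain ⟨q, r, hr, hball, h0⟩ := exists_closedBall_subset_zero_mem_convexHull hKc hK hKi
  obtain ⟨u, hu⟩ := convexHull_nonempty_iff.1 ⟨_, h0⟩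
  have hu0 : u ≠ 0 := by rw [← norm_pos_iff, hu.1]; exact one_pos
  obtain ⟨x, hx, hcon⟩ := h u hu0
  have hkK : q + r • u ∈ K := hball (by
    rw [mem_closedBall_iff_norm, add_sub_cancel_left, norm_smul, hu.1, mul_one,
      Real.norm_of_nonneg hr.le])
  obtain ⟨l, hl, hlmax⟩ := hL.exists_isMaxOn (hLi.mono interior_subset)
    (f := fun y => inner ℝ y u) (by fun_prop)
  obtain ⟨hlt, hcap⟩ := truncated_cone_of_contact hKc hLc hK hL hr hball hu
    (hx.volume_pos hKi hLi) hl (fun y hy => hlmax hy)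
    (hcon _ hkK hu.2 l hl fun y hy => hlmax hy)
  set k := q + r • u with hk
  refine ⟨x, hx, ?_⟩
  set c := inner ℝ (x - k) u - inner ℝ l u with hc
  have hc0 : c < 0 := by linarith
  -- Since `c < 0`, the half-space `φ ≤ 1` is the one containing `x - K - l`.
  set φ : E →L[ℝ] ℝ := c⁻¹ • innerSL ℝ u with hφ
  have hφle : ∀ w, φ w ≤ 1 ↔ c ≤ inner ℝ w u := by
    intro w
    rw [hφ, smul_apply, innerSL_apply_apply, smul_eq_mul, real_inner_comm,
      inv_mul_eq_div, div_le_one_of_neg hc0]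
  set P : Set E := {w | w + l ∈ L} with hP
  set Q : Set E := {w | x - (w + l) ∈ K} with hQ
  have hPQ : ∀ b, volume {w | w + b ∈ P ∧ w ∈ Q} = volume (overlap L K (x + b)) := by
    intro b
    rw [← volume_preimage_add_right_vec (overlap L K (x + b)) (b + l)]
    congr 1
    ext w
    simp only [overlap, hP, hQ, mem_ofPred_eq, ← add_assoc]
    rw [show x + b - (w + b + l) = x - (w + l) by abel]
  have hPQ0 : {w | w + 0 ∈ P ∧ w ∈ Q} = P ∩ Q := by ext w; simp
  have hvol0 := hPQ 0
  rw [hPQ0, add_zero] at hvol0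
  have hPc : Convex ℝ P := hLc.translate_preimage_left l
  have hQc : Convex ℝ Q := by
    intro a ha b hb s t hs ht hst
    have := hKc ha hb hs ht hst
    simp only [hQ, mem_ofPred_eq]
    convert this using 1
    have e : x - l = (s + t) • (x - l) := by rw [hst, one_smul]
    rw [sub_add_eq_sub_sub_swap, e]
    module
  have hPcomp : IsCompact P := by
    have : P = (fun y => y - l) '' L := by
      ext w; simp only [hP, mem_ofPred_eq, mem_image]
      exact ⟨fun hw => ⟨_, hw, by abel⟩, by rintro ⟨y, hy, rfl⟩; simpa using hy⟩
    rw [this]; exact hL.image (by fun_prop)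
  have hQcomp : IsCompact Q := by
    have : Q = (fun y => x - y - l) '' K := by
      ext w; simp only [hQ, mem_ofPred_eq, mem_image]
      refine ⟨fun hw => ⟨_, hw, by abel⟩, ?_⟩
      rintro ⟨y, hy, rfl⟩
      simpa using hy
    rw [this]; exact hK.image (by fun_prop)
  have hcap' : ∀ w ∈ apexCone P, φ w ≤ 1 → w ∈ P ∩ Q := by
    rintro w ⟨t, ht, hw⟩ hφw
    rw [hφle] at hφw
    refine hcap (w + l) t ht ?_ ?_
    · rw [add_sub_cancel_right, add_comm]; exact hw
    · rw [inner_add_left w]; linarith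
  have hQφ : ∀ w ∈ Q, φ w ≤ 1 := by
    intro w hw
    rw [hφle]
    have := hu.2 _ hw
    rw [inner_sub_left x, inner_add_left w] at this
    rw [hc, inner_sub_left x]
    linarith
  by_cases hPφ : ∀ p ∈ P, φ p ≤ 1
  · left
    intro w hw
    have hwP : w - l ∈ P := by simpa [hP] using hw
    have := (hcap' _ (subset_apexCone hwP) (hPφ _ hwP)).2
    simpa [hQ] using this
  right
  push Not at hPφ
  obtain ⟨p, hp, hφp⟩ := hPφ
  by_contra hcon'
  push Not at hcon'
  obtain ⟨y, hy, hyL⟩ := hcon'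
  obtain ⟨b, hb⟩ := exists_translate_volume_lt hPc hQc hPcomp hQcomp φ
    (by simpa [hP] using hl) hcap' hQφ
    ((hPc.inter hQc).interior_nonempty_of_volume_pos
      (by rw [hvol0, volume_overlap_swap]; exact hx.volume_pos hKi hLi))
    hp hφp (q := x - y - l) (by simpa [hQ] using hy) (by simpa [hP] using hyL)
  rw [hPQ, hvol0] at hb
  exact absurd (hx.swap (x + b)) (not_le.2 hb)

end Cap

/-! ### Barycentric coordinates and the recognition of simplices. -/

section

variable {E : Type*} [NormedAddCommGroup E] [InnerProductSpace ℝ E]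

theorem AffineBasis.coord_eq_linear_add {ι : Type*} (b : AffineBasis ι ℝ E) (i : ι) (x : E) :
    b.coord i x = (b.coord i).linear x + b.coord i 0 := by
  have := (b.coord i).map_vadd 0 x
  simpa using this

theorem AffineBasis.sum_linear_eq_zero {ι : Type*} [Fintype ι] (b : AffineBasis ι ℝ E) (x : E) :
    ∑ i, (b.coord i).linear x = 0 := by
  have h1 := b.sum_coord_apply_eq_one x
  have h2 := b.sum_coord_apply_eq_one (0 : E)
  simp only [b.coord_eq_linear_add _ x, Finset.sum_add_distrib, h2] at h1
  linarith

theorem AffineBasis.ext_linear {ι : Type*} [Finite ι] (b : AffineBasis ι ℝ E) {x y : E}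
    (h : ∀ i, (b.coord i).linear x = (b.coord i).linear y) : x = y :=
  b.ext_elem fun i => by rw [b.coord_eq_linear_add _ x, b.coord_eq_linear_add _ y, h]

theorem AffineBasis.mem_convexHull_iff {ι : Type*} (b : AffineBasis ι ℝ E) {x : E} :
    x ∈ convexHull ℝ (range b) ↔ ∀ i, 0 ≤ b.coord i x := by
  rw [b.convexHull_eq_nonneg_coord]; rfl

end

section

variable {E : Type*} [NormedAddCommGroup E] [InnerProductSpace ℝ E] [FiniteDimensional ℝ E]

/-- A convex body is a simplex if every contact normal `u` of a largest inscribed ball has an apex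
`a` such that all points off the facet with normal `u` can be pushed away from `a`. -/
theorem exists_affineBasis_of_apexes {L : Set E} (hLc : Convex ℝ L) (hL : IsCompact L)
    (hLi : (interior L).Nonempty) {q : E} {r : ℝ} (hr : 0 < r)
    (h0 : (0 : E) ∈ convexHull ℝ (contactNormals L q r)) (a : E → E)
    (haL : ∀ u ∈ contactNormals L q r, a u ∈ L)
    (ha : ∀ u ∈ contactNormals L q r, ∀ y ∈ L, y ≠ a u →
      inner ℝ y u < inner ℝ (q + r • u) u → ∃ ε : ℝ, 0 < ε ∧ a u + (1 + ε) • (y - a u) ∈ L) :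
    ∃ b : AffineBasis (Fin (Module.finrank ℝ E + 1)) ℝ E, L = convexHull ℝ (range b) ∧
      ∀ i, ∃ u ∈ contactNormals L q r, b i = a u := by
  obtain ⟨ι, _, v, w, hv, hvi, hw, hw1, hwv⟩ := eq_pos_convex_span_of_mem_convexHull h0
  have hvU : ∀ i, v i ∈ contactNormals L q r := fun i => hv ⟨i, rfl⟩
  set a' : ι → E := fun i => a (v i) with ha'
  -- An extreme point that is no apex cannot be pushed away from one, so it lies on every supporting
  -- hyperplane. Averaging these equations with the weights `w`, for which `∑ w i • v i = 0`, gives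
  -- `r = 0`.
  have hext : L.extremePoints ℝ ⊆ range a' := by
    intro y hy
    by_contra hya
    rw [mem_extremePoints] at hy
    have heq : ∀ i, inner ℝ y (v i) = inner ℝ q (v i) + r := by
      intro i
      have huu : inner ℝ (q + r • v i) (v i) = inner ℝ q (v i) + r := by
        rw [inner_add_left, real_inner_smul_left, real_inner_self_eq_norm_sq, (hvU i).1]; ring
      rw [← huu]
      refine le_antisymm ((hvU i).2 y hy.1) (not_lt.1 fun hlt => ?_)
      have hne : y ≠ a (v i) := fun h => hya ⟨i, h.symm⟩
      obtain ⟨ε, hε, hmem⟩ := ha _ (hvU i) y hy.1 hne hlt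
      have hseg : y ∈ openSegment ℝ (a (v i)) (a (v i) + (1 + ε) • (y - a (v i))) := by
        rw [openSegment_eq_image']
        refine ⟨1 / (1 + ε), ⟨by positivity, by rw [div_lt_one (by positivity)]; linarith⟩, ?_⟩
        simp only [add_sub_cancel_left]
        rw [smul_smul, one_div_mul_cancel (by positivity), one_smul, add_sub_cancel]
      exact hne (hy.2 _ (haL _ (hvU i)) _ hmem hseg).1.symm
    have h1 : ∀ z : E, ∑ i, w i * inner ℝ z (v i) = 0 := by
      intro z
      rw [← inner_zero_right (𝕜 := ℝ) z, ← hwv, inner_sum]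
      simp only [real_inner_smul_right]
    have h2 := h1 y
    simp only [heq, mul_add, Finset.sum_add_distrib, h1 q, ← Finset.sum_mul, hw1] at h2
    linarith
  have hconv : L = convexHull ℝ (range a') := by
    apply Subset.antisymm
    · conv_lhs => rw [← closure_convexHull_extremePoints hL hLc]
      exact closure_minimal (convexHull_mono hext) ((finite_range a').isClosed_convexHull ℝ)
    · refine convexHull_min ?_ hLc
      rintro _ ⟨i, rfl⟩
      exact haL _ (hvU i)
  have htop : affineSpan ℝ (range a') = ⊤ := by
    rw [← interior_convexHull_nonempty_iff_affineSpan_eq_top, ← hconv]; exact hLi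
  have hne : Nonempty ι := by
    by_contra h
    rw [not_nonempty_iff] at h
    simp at hw1
  have hcard : Fintype.card ι ≤ Module.finrank ℝ E + 1 :=
    hvi.card_le_finrank_succ.trans (Nat.succ_le_succ (Submodule.finrank_le _))
  -- At most `n + 1` points (`n` the dimension of `E`) that affinely span the whole space are
  -- independent.
  have hind : AffineIndependent ℝ a' := by
    obtain ⟨m, hm⟩ := Nat.exists_eq_succ_of_ne_zero (Fintype.card_ne_zero (α := ι))
    rw [affineIndependent_iff_le_finrank_vectorSpan ℝ a' hm, ← direction_affineSpan, htop,
      AffineSubspace.direction_top, finrank_top]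
    omega
  let b : AffineBasis ι ℝ E := ⟨a', hind, htop⟩
  have e : ι ≃ Fin (Module.finrank ℝ E + 1) :=
    Fintype.equivFinOfCardEq b.card_eq_finrank_add_one
  refine ⟨b.reindex e, ?_, fun i => ⟨v (e.symm i), hvU _, rfl⟩⟩
  rw [AffineBasis.coe_reindex, EquivLike.range_comp]
  exact hconv

/-- A convex body that contains, for every vertex of a simplex `L`, an apex of a cone that is
opposite to the cone of `L` at the vertex and contains the body, is homothetic to `-L`. -/
theorem exists_homothety_of_opposite_cones [Nontrivial E] {ι : Type*} [Fintype ι] {K : Set E}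
    (b : AffineBasis ι ℝ E) (hKc : Convex ℝ K) (hKi : (interior K).Nonempty)
    (h : ∀ i, ∃ κ ∈ K, ∀ p ∈ K, ∃ t : ℝ, 0 < t ∧ b i - t • (p - κ) ∈ convexHull ℝ (range b)) :
    ∃ (z : E) (s : ℝ), 0 < s ∧ ∀ y, y ∈ convexHull ℝ (range b) ↔ z - s • y ∈ K := by
  classical
  choose κ hκ hcone using h
  have hnt : Nontrivial ι := by
    rw [← Fintype.one_lt_card_iff_nontrivial, b.card_eq_finrank_add_one]
    have := Module.finrank_pos (R := ℝ) (M := E)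
    omega
  set B : ι → E →ₗ[ℝ] ℝ := fun i => (b.coord i).linear with hB
  have hBle : ∀ i j, j ≠ i → ∀ p ∈ K, B j p ≤ B j (κ i) := by
    intro i j hj p hp
    obtain ⟨t, ht, hmem⟩ := hcone i p hp
    have h1 := b.mem_convexHull_iff.1 hmem j
    rw [b.coord_eq_linear_add, map_sub, sub_add_eq_add_sub, ← b.coord_eq_linear_add,
      b.coord_apply_ne hj, map_smul, map_sub, smul_eq_mul, zero_sub] at h1
    have h2 : t * (B j p - B j (κ i)) ≤ 0 := by linarith
    have := nonpos_of_mul_nonpos_right h2 ht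
    linarith
  choose i' hi' using fun j : ι => exists_ne j
  -- The maximum of `B j` on `K`, attained at every `κ i` with `i ≠ j`. As the `B j` sum to zero,
  -- all coordinates of each `κ i` are then known.
  set μ : ι → ℝ := fun j => B j (κ (i' j)) with hμ
  have hle : ∀ p ∈ K, ∀ j, B j p ≤ μ j := fun p hp j => hBle _ _ (hi' j).symm p hp
  have hκμ : ∀ i j, j ≠ i → B j (κ i) = μ j := fun i j hj =>
    le_antisymm (hle _ (hκ i) j) (hBle i j hj _ (hκ _))
  set s := ∑ j, μ j with hs
  have hsum : ∀ x, ∑ j, B j x = 0 := b.sum_linear_eq_zero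
  have hκi : ∀ i, B i (κ i) = μ i - s := by
    intro i
    have h1 := hsum (κ i)
    rw [← Finset.add_sum_erase _ _ (Finset.mem_univ i)] at h1
    rw [hs, ← Finset.add_sum_erase _ _ (Finset.mem_univ i)]
    have h2 : ∑ j ∈ Finset.univ.erase i, B j (κ i) = ∑ j ∈ Finset.univ.erase i, μ j :=
      Finset.sum_congr rfl fun j hj => hκμ i j (Finset.ne_of_mem_erase hj)
    linarith
  have hi₀ : ι := (i' (Classical.choice inferInstance))
  have hs0 : 0 < s := by
    have hsp : ∀ p, s = ∑ j, (μ j - B j p) := fun p => by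
      rw [Finset.sum_sub_distrib, hsum, sub_zero]
    refine lt_of_le_of_ne ?_ fun hz => ?_
    · rw [hsp (κ hi₀)]
      exact Finset.sum_nonneg fun j _ => sub_nonneg.2 (hle _ (hκ _) j)
    · have hK : K ⊆ {κ hi₀} := by
        intro p hp
        have hall : ∀ p ∈ K, ∀ j, B j p = μ j := by
          intro p hp j
          have h1 := (Finset.sum_eq_zero_iff_of_nonneg
            (fun j _ => sub_nonneg.2 (hle p hp j))).1 ((hsp p).symm.trans hz.symm) j
              (Finset.mem_univ j)
          linarith
        exact b.ext_linear fun j => (hall p hp j).trans (hall _ (hκ _) j).symm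
      obtain ⟨o, ho⟩ := hKi
      have := interior_mono hK ho
      rw [interior_singleton] at this
      exact this
  have hBb : ∀ i j, B j (b i) = (if j = i then 1 else 0) - b.coord j 0 := by
    intro i j
    rw [← b.coord_apply, b.coord_eq_linear_add j (b i)]
    simp [hB]
  set z := κ hi₀ + s • b hi₀ with hz
  have hBκ : ∀ i j, B j (κ i + s • b i) = μ j - s * b.coord j 0 := by
    intro i j
    rw [map_add, map_smul, hBb, smul_eq_mul]
    split_ifs with hij
    · subst hij; rw [hκi]; ring
    · rw [hκμ i j hij]; ring
  have hzi : ∀ i, κ i = z - s • b i := by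
    intro i
    rw [eq_sub_iff_add_eq]
    exact b.ext_linear fun j => (hBκ i j).trans (hBκ hi₀ j).symm
  refine ⟨z, s, hs0, fun y => ⟨fun hy => ?_, fun hy => ?_⟩⟩
  · have hconv : Convex ℝ {y | z - s • y ∈ K} := by
      intro y₁ h₁ y₂ h₂ c d hc hd hcd
      have := hKc h₁ h₂ hc hd hcd
      simp only [mem_ofPred_eq]
      convert this using 1
      have e : z = (c + d) • z := by rw [hcd, one_smul]
      nth_rewrite 1 [e]
      module
    refine convexHull_min ?_ hconv hy
    rintro _ ⟨i, rfl⟩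
    simp only [mem_ofPred_eq]
    rw [← hzi]; exact hκ i
  · rw [b.mem_convexHull_iff]
    intro j
    have h1 := hle _ hy j
    rw [map_sub, map_smul, hz, hBκ, smul_eq_mul] at h1
    rw [b.coord_eq_linear_add]
    have h2 : 0 ≤ s * (B j y + b.coord j 0) := by linarith
    exact nonneg_of_mul_nonneg_right h2 hs0

variable [MeasurableSpace E] [BorelSpace E]

/-- With the roles exchanged, the cone of `K` at `κ`, truncated by a hyperplane, lies in `x - L`;
the apex is `a = x - κ`. As `L ⊆ x - K`, a point of `L` dilated from `a` stays in the reflected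
cone, so it stays in `L` up to the supporting height of `u`. -/
theorem HasConicalOverlaps.exists_apex {K L : Set E} (h : HasConicalOverlaps K L)
    (hKc : Convex ℝ K) (hLc : Convex ℝ L) (hK : IsCompact K) (hL : IsCompact L)
    (hKi : (interior K).Nonempty) (hLi : (interior L).Nonempty)
    (hmax : ∀ x, IsMaxOverlap K L x → ∀ w ∈ L, x - w ∈ K) {q : E} {r : ℝ} (hr : 0 < r)
    (hball : Metric.closedBall q r ⊆ L) {u : E} (hu : u ∈ contactNormals L q r) :
    ∃ a ∈ L, ∃ κ ∈ K,
      (∀ y ∈ L, y ≠ a → inner ℝ y u < inner ℝ (q + r • u) u →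
        ∃ ε : ℝ, 0 < ε ∧ a + (1 + ε) • (y - a) ∈ L) ∧
      ∀ p ∈ K, ∃ t : ℝ, 0 < t ∧ a - t • (p - κ) ∈ L := by
  have hu0 : u ≠ 0 := by rw [← norm_pos_iff, hu.1]; exact one_pos
  obtain ⟨x, hx, hcon⟩ := h.swap u hu0
  have hkL : q + r • u ∈ L := hball (by
    rw [mem_closedBall_iff_norm, add_sub_cancel_left, norm_smul, hu.1, mul_one,
      Real.norm_of_nonneg hr.le])
  obtain ⟨κ, hκ, hκmax⟩ := hK.exists_isMaxOn (hKi.mono interior_subset)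
    (f := fun y => inner ℝ y u) (by fun_prop)
  obtain ⟨hlt, hcap⟩ := truncated_cone_of_contact hLc hKc hL hK hr hball hu
    (hx.volume_pos hLi hKi) hκ (fun y hy => hκmax hy)
    (hcon _ hkL hu.2 κ hκ fun y hy => hκmax hy)
  set k := q + r • u with hk
  rw [inner_sub_left] at hlt hcap
  have hLK := hmax x hx.swap
  have haL : x - κ ∈ L := (hcap κ 1 (by simp) (by simpa using hκ) hlt.le).2
  refine ⟨x - κ, haL, κ, hκ, fun y hy hya hyu => ?_, fun p hp => ?_⟩
  -- The summand `1` keeps the divisor positive; `ε` spends at most the slack below the supporting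
  -- hyperplane.
  · set m : ℝ := |inner ℝ (y - (x - κ)) u| + 1 with hm
    have hm0 : 0 < m := by positivity
    set ε := (inner ℝ k u - inner ℝ y u) / m with hε
    have hε0 : 0 < ε := div_pos (by linarith) hm0
    refine ⟨ε, hε0, ?_⟩
    have h1 := (hcap (κ - (1 + ε) • (y - (x - κ))) (1 / (1 + ε))
      ⟨by positivity, by rw [div_le_one (by positivity)]; linarith⟩ ?_ ?_).2
    · convert h1 using 1
      abel
    · have e : κ + (1 / (1 + ε)) • (κ - (1 + ε) • (y - (x - κ)) - κ) = x - y := by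
        rw [sub_sub_cancel_left, smul_neg, smul_smul, one_div_mul_cancel (by positivity), one_smul]
        abel
      rw [e]; exact hLK y hy
    · have h2 : ε * inner ℝ (y - (x - κ)) u ≤ inner ℝ k u - inner ℝ y u := by
        calc ε * inner ℝ (y - (x - κ)) u ≤ ε * m := by
              gcongr
              have := le_abs_self (inner ℝ (y - (x - κ)) u)
              linarith
          _ = _ := by rw [hε, div_mul_cancel₀ _ hm0.ne']
      rw [inner_sub_left κ, real_inner_smul_left]
      have h3 : inner ℝ (y - (x - κ)) u = inner ℝ y u - (inner ℝ x u - inner ℝ κ u) := by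
        rw [inner_sub_left, inner_sub_left]
      rw [h3] at h2 ⊢
      linarith
  · set m : ℝ := |inner ℝ (κ - p) u| + 1 with hm
    have hm0 : 0 < m := by positivity
    set g := inner ℝ κ u - (inner ℝ x u - inner ℝ k u) with hg
    have hg0 : 0 < g := by linarith
    set t := min 1 (g / m) with ht
    have ht0 : 0 < t := lt_min one_pos (div_pos hg0 hm0)
    refine ⟨t, ht0, ?_⟩
    have h1 := (hcap (κ + t • (p - κ)) 1 (by simp) ?_ ?_).2
    · convert h1 using 1
      abel
    · rw [one_smul, add_sub_cancel]
      exact hKc.add_smul_sub_mem hκ hp ⟨ht0.le, min_le_left _ _⟩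
    · have h2 : t * inner ℝ (κ - p) u ≤ g := by
        calc t * inner ℝ (κ - p) u ≤ t * m := by
              gcongr
              have := le_abs_self (inner ℝ (κ - p) u)
              linarith
          _ ≤ g / m * m := by gcongr; exact min_le_right _ _
          _ = g := div_mul_cancel₀ _ hm0.ne'
      rw [inner_add_left κ, real_inner_smul_left, ← neg_sub κ p, inner_neg_left]
      linarith

/-- A single inclusion makes the maximal volume that of `L`, so the inclusion holds at every
maximiser, in particular at the one belonging to each contact normal. -/
theorem HasConicalOverlaps.exists_simplex_of_subset [Nontrivial E] {K L : Set E}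
    (h : HasConicalOverlaps K L) (hKc : Convex ℝ K) (hLc : Convex ℝ L) (hK : IsCompact K)
    (hL : IsCompact L) (hKi : (interior K).Nonempty) (hLi : (interior L).Nonempty) {x₀ : E}
    (hx₀ : ∀ w ∈ L, x₀ - w ∈ K) :
    ∃ b : AffineBasis (Fin (Module.finrank ℝ E + 1)) ℝ E, L = convexHull ℝ (range b) ∧
      ∃ (z : E) (s : ℝ), 0 < s ∧ ∀ y, y ∈ L ↔ z - s • y ∈ K := by
  have hmax : ∀ x, IsMaxOverlap K L x → ∀ w ∈ L, x - w ∈ K := by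
    intro x hx w hw
    have hle : volume L ≤ volume (overlap L K x) :=
      (measure_mono (show L ⊆ overlap L K x₀ from fun w hw => ⟨hw, hx₀ w hw⟩)).trans (hx.swap x₀)
    have := hLc.subset_of_volume_le (isCompact_overlap hL hK x).isClosed (fun w hw => hw.1)
      (hx.swap.volume_pos hLi hKi) hle
      ((measure_mono fun w hw => hw.1).trans_lt hL.measure_lt_top).ne
    exact (this hw).2
  obtain ⟨q, r, hr, hball, h0⟩ := exists_closedBall_subset_zero_mem_convexHull hLc hL hLi
  choose! a haL κ hκ h1 h2 using fun u (hu : u ∈ contactNormals L q r) =>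
    h.exists_apex hKc hLc hK hL hKi hLi hmax hr hball hu
  obtain ⟨b, hb, hba⟩ := exists_affineBasis_of_apexes hLc hL hLi hr h0 a haL h1
  refine ⟨b, hb, ?_⟩
  have := exists_homothety_of_opposite_cones b hKc hKi fun i => by
    obtain ⟨u, hu, hi⟩ := hba i
    refine ⟨κ u, hκ u hu, fun p hp => ?_⟩
    rw [← hb, hi]
    exact h2 u hu p hp
  rwa [← hb] at this

end

/-! ### Overlap ratios of homothetic simplices. -/

/-- The vector `β` is the positive part of `α` (for `c ≤ 1`) or minus its negative part (for `c >
1`), rescaled to sum `1 - c`. The scale is at most `1`, so subtracting `τ β` reverses no sign. -/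
theorem exists_split_positive_parts {ι : Type*} [Fintype ι] (α : ι → ℝ) {c τ : ℝ}
    (hα : ∑ j, α j = 1 - c) (hτ : τ ∈ Icc (0 : ℝ) 1)
    (hle : ∑ j, max 0 (α j) ≤ 1 - τ * min 1 c) :
    ∃ β : ι → ℝ, ∑ j, β j = 1 - c ∧ ∑ j, max 0 (β j) ≤ 1 - min 1 c ∧
      ∑ j, max 0 (α j - τ * β j) ≤ 1 - τ := by
  set p := ∑ j, max 0 (α j) with hp
  have hp0 : 0 ≤ p := Finset.sum_nonneg fun j _ => le_max_left _ _
  have hpc : 1 - c ≤ p := by rw [← hα]; exact Finset.sum_le_sum fun j _ => le_max_right _ _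
  rcases le_or_gt c 1 with h1 | h1
  · rw [min_eq_right h1] at hle ⊢
    set m := (1 - c) / p with hm
    have hm0 : 0 ≤ m := div_nonneg (by linarith) hp0
    have hm1 : m ≤ 1 := div_le_one_of_le₀ hpc hp0
    have hmp : m * p = 1 - c := by
      rcases eq_or_ne p 0 with h | h
      · rw [h, mul_zero]; linarith
      · exact div_mul_cancel₀ _ h
    refine ⟨fun j => m * max 0 (α j), ?_, ?_, ?_⟩
    · rw [← Finset.mul_sum, hmp]
    · have : ∀ j, max 0 (m * max 0 (α j)) = m * max 0 (α j) := fun j =>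
        max_eq_right (mul_nonneg hm0 (le_max_left _ _))
      simp only [this]
      rw [← Finset.mul_sum, hmp]
    · have hτm : τ * m ≤ 1 := mul_le_one₀ hτ.2 hm0 hm1
      calc ∑ j, max 0 (α j - τ * (m * max 0 (α j))) ≤ ∑ j, (1 - τ * m) * max 0 (α j) := by
            refine Finset.sum_le_sum fun j _ => max_le ?_ ?_
            · exact mul_nonneg (by linarith) (le_max_left _ _)
            · have := le_max_right 0 (α j)
              linarith
        _ = p - τ * (m * p) := by rw [← Finset.mul_sum]; ring
        _ ≤ 1 - τ := by rw [hmp]; linarith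
  · rw [min_eq_left h1.le] at hle ⊢
    set q := ∑ j, max 0 (-α j) with hq
    have hpq : p - q = 1 - c := by
      rw [← hα, hp, hq, ← Finset.sum_sub_distrib]
      exact Finset.sum_congr rfl fun j _ => by
        rcases le_total 0 (α j) with h | h
        · rw [max_eq_right h, max_eq_left (by linarith)]; ring
        · rw [max_eq_left h, max_eq_right (by linarith)]; ring
    have hq0 : 0 < q := by linarith
    set m := (c - 1) / q with hm
    have hm0 : 0 ≤ m := div_nonneg (by linarith) hq0.le
    have hm1 : m ≤ 1 := div_le_one_of_le₀ (by linarith) hq0.le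
    have hmq : m * q = c - 1 := div_mul_cancel₀ _ hq0.ne'
    refine ⟨fun j => -(m * max 0 (-α j)), ?_, ?_, ?_⟩
    · rw [Finset.sum_neg_distrib, ← Finset.mul_sum, hmq]; ring
    · have : ∀ j, max 0 (-(m * max 0 (-α j))) = 0 := fun j =>
        max_eq_left (neg_nonpos.2 (mul_nonneg hm0 (le_max_left _ _)))
      simp [this]
    · have hτm : τ * m ≤ 1 := mul_le_one₀ hτ.2 hm0 hm1
      calc ∑ j, max 0 (α j - τ * -(m * max 0 (-α j))) ≤ ∑ j, max 0 (α j) := by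
            refine Finset.sum_le_sum fun j _ => max_le (le_max_left _ _) ?_
            have e : α j = max 0 (α j) - max 0 (-α j) := by
              rcases le_total 0 (α j) with h | h
              · rw [max_eq_right h, max_eq_left (by linarith)]; ring
              · rw [max_eq_left h, max_eq_right (by linarith)]; ring
            have h2 : τ * m * max 0 (-α j) ≤ max 0 (-α j) :=
              mul_le_of_le_one_left (le_max_left _ _) hτm
            linarith
        _ ≤ 1 - τ := by linarith

section

variable {E : Type*} [NormedAddCommGroup E] [InnerProductSpace ℝ E] {ι : Type*}

/-- The lower bound for the `j`-th barycentric coordinate on `x + z + c K`, where `K` is the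
simplex with vertices `b`. -/
noncomputable def coordBound (b : AffineBasis ι ℝ E) (z : E) (c : ℝ) (j : ι) (x : E) : ℝ :=
  (b.coord j).linear (x + z) + (1 - c) * b.coord j 0

theorem coordBound_combo (b : AffineBasis ι ℝ E) (z : E) (c : ℝ) (j : ι) (x y : E) {s t : ℝ}
    (hst : s + t = 1) :
    coordBound b z c j (s • x + t • y) = s * coordBound b z c j x + t * coordBound b z c j y := by
  obtain rfl : t = 1 - s := by linarith
  simp only [coordBound, map_add, map_smul, smul_eq_mul]
  ring

variable {K L : Set E} {b : AffineBasis ι ℝ E} {z : E} {c : ℝ}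

/-- Here `x - L = x + z + c K`, so each coordinate has one lower bound from `K` and one from this
copy. -/
theorem overlap_eq_setOf_le_coord (hc : 0 < c) (hK : K = convexHull ℝ (range b))
    (hL : -L = {z} + c • K) (x : E) :
    overlap K L x = {y | ∀ j, max 0 (coordBound b z c j x) ≤ b.coord j y} := by
  have hLmem : ∀ y, y ∈ L ↔ c⁻¹ • (-y - z) ∈ K := by
    intro y
    rw [← neg_neg y, ← Set.mem_neg, hL, singleton_add, mem_image, neg_neg]
    constructor
    · rintro ⟨_, ⟨k, hk, rfl⟩, hy⟩
      rw [← hy, add_sub_cancel_left, inv_smul_smul₀ hc.ne']; exact hk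
    · intro h
      exact ⟨_, ⟨_, h, rfl⟩, by simp only; rw [smul_inv_smul₀ hc.ne', add_sub_cancel]⟩
  ext y
  simp only [overlap, mem_ofPred_eq, hLmem, hK, b.mem_convexHull_iff, max_le_iff, forall_and]
  refine and_congr_right fun _ => forall_congr' fun j => ?_
  rw [b.coord_eq_linear_add j (c⁻¹ • _), b.coord_eq_linear_add j y, coordBound, map_smul,
    smul_eq_mul, show -(x - y) - z = y - (x + z) by abel, map_sub,
    ← mul_le_mul_iff_right₀ hc, mul_zero, mul_add, mul_inv_cancel_left₀ hc.ne']
  constructor <;> intro h <;> linarith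

variable [Fintype ι]

theorem AffineBasis.linear_sum_smul (b : AffineBasis ι ℝ E) (m : ι → ℝ) (j : ι) :
    (b.coord j).linear (∑ i, m i • b i) = m j - (∑ i, m i) * b.coord j 0 := by
  classical
  have h : ∀ i, (b.coord j).linear (b i) = (if j = i then 1 else 0) - b.coord j 0 := by
    intro i
    rw [← b.coord_apply, b.coord_eq_linear_add j (b i), add_sub_cancel_right]
  simp only [map_sum, map_smul, h, smul_eq_mul, mul_sub, Finset.sum_sub_distrib, mul_ite, mul_one,
    mul_zero, Finset.sum_ite_eq, Finset.mem_univ, if_true, Finset.sum_mul]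

/-- Points with barycentric coordinates bounded below form a homothetic copy of the simplex. -/
theorem AffineBasis.setOf_le_coord_eq (b : AffineBasis ι ℝ E) (m : ι → ℝ) (hm : ∑ i, m i ≤ 1) :
    {y | ∀ j, m j ≤ b.coord j y} =
      {∑ i, m i • b i} + (1 - ∑ i, m i) • convexHull ℝ (range b) := by
  have hcoord : ∀ k j, b.coord j (∑ i, m i • b i + (1 - ∑ i, m i) • k)
      = m j + (1 - ∑ i, m i) * b.coord j k := by
    intro k j
    rw [b.coord_eq_linear_add, map_add, b.linear_sum_smul, map_smul, smul_eq_mul,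
      b.coord_eq_linear_add j k]
    ring
  set s := 1 - ∑ i, m i with hs
  have hs0 : 0 ≤ s := by linarith
  ext y
  simp only [mem_ofPred_eq, singleton_add, mem_image, mem_smul_set]
  constructor
  · intro hy
    -- When the ratio vanishes, the bounds determine a single point and rescaling by `s⁻¹` is
    -- impossible.
    rcases eq_or_lt_of_le hs0 with h0 | h0
    · obtain ⟨i₀⟩ := b.nonempty
      refine ⟨_, ⟨b i₀, subset_convexHull ℝ _ ⟨i₀, rfl⟩, rfl⟩, b.ext_elem fun j => ?_⟩
      rw [hcoord, ← h0, zero_mul, add_zero]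
      have h1 : ∑ j, (b.coord j y - m j) = 0 := by
        rw [Finset.sum_sub_distrib, b.sum_coord_apply_eq_one]; linarith
      have h2 := (Finset.sum_eq_zero_iff_of_nonneg fun j _ => sub_nonneg.2 (hy j)).1 h1 j
        (Finset.mem_univ j)
      linarith
    · refine ⟨_, ⟨s⁻¹ • (y - ∑ i, m i • b i), ?_, rfl⟩, ?_⟩
      · rw [b.mem_convexHull_iff]
        intro j
        have h1 := hcoord (s⁻¹ • (y - ∑ i, m i • b i)) j
        rw [smul_inv_smul₀ h0.ne', add_sub_cancel] at h1
        have h2 := hy j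
        rw [h1] at h2
        exact nonneg_of_mul_nonneg_right (by linarith) h0
      · rw [smul_inv_smul₀ h0.ne', add_sub_cancel]
  · rintro ⟨_, ⟨k, hk, rfl⟩, rfl⟩ j
    rw [hcoord]
    have := mul_nonneg hs0 (b.mem_convexHull_iff.1 hk j)
    linarith

/-- The ratio of the simplex `K ∩ (x + z + c K)` to the simplex `K` with vertices `b`. -/
noncomputable def overlapRatio (b : AffineBasis ι ℝ E) (z : E) (c : ℝ) (x : E) : ℝ :=
  1 - ∑ j, max 0 (coordBound b z c j x)

theorem sum_coordBound (b : AffineBasis ι ℝ E) (z : E) (c : ℝ) (x : E) :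
    ∑ j, coordBound b z c j x = 1 - c := by
  simp only [coordBound, Finset.sum_add_distrib, b.sum_linear_eq_zero, ← Finset.mul_sum,
    b.sum_coord_apply_eq_one]
  ring

theorem exists_coordBound_eq (b : AffineBasis ι ℝ E) (z : E) {c : ℝ} (β : ι → ℝ)
    (hβ : ∑ j, β j = 1 - c) : ∃ x, ∀ j, coordBound b z c j x = β j := by
  refine ⟨∑ i, β i • b i - z, fun j => ?_⟩
  rw [coordBound, sub_add_cancel, b.linear_sum_smul, hβ]
  ring

theorem overlapRatio_combo_ge (b : AffineBasis ι ℝ E) (z : E) (c : ℝ) (x y : E) {s t : ℝ}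
    (hs : 0 ≤ s) (ht : 0 ≤ t) (hst : s + t = 1) :
    s * overlapRatio b z c x + t * overlapRatio b z c y ≤ overlapRatio b z c (s • x + t • y) := by
  have h : ∑ j, max 0 (coordBound b z c j (s • x + t • y)) ≤
      ∑ j, (s * max 0 (coordBound b z c j x) + t * max 0 (coordBound b z c j y)) := by
    refine Finset.sum_le_sum fun j _ => ?_
    rw [coordBound_combo b z c j x y hst]
    refine max_le ?_ ?_
    · positivity
    · gcongr <;> exact le_max_right _ _
  rw [Finset.sum_add_distrib, ← Finset.mul_sum, ← Finset.mul_sum] at h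
  unfold overlapRatio
  linarith

theorem overlapRatio_le (b : AffineBasis ι ℝ E) (z : E) (c : ℝ) (x : E) :
    overlapRatio b z c x ≤ min 1 c := by
  refine le_min ?_ ?_
  · have : 0 ≤ ∑ j, max 0 (coordBound b z c j x) :=
      Finset.sum_nonneg fun j _ => le_max_left _ _
    unfold overlapRatio; linarith
  · have : ∑ j, coordBound b z c j x ≤ ∑ j, max 0 (coordBound b z c j x) :=
      Finset.sum_le_sum fun j _ => le_max_right _ _
    rw [sum_coordBound] at this
    unfold overlapRatio; linarith

theorem exists_le_overlapRatio (b : AffineBasis ι ℝ E) (z : E) {c : ℝ} :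
    ∃ x, min 1 c ≤ overlapRatio b z c x := by
  classical
  obtain ⟨i⟩ := b.nonempty
  -- All of the prescribed sum goes to one coordinate: the two simplices share a vertex and the
  -- smaller lies in the larger.
  obtain ⟨x, hx⟩ := exists_coordBound_eq b z (c := c) (fun j => if j = i then 1 - c else 0)
    (by simp)
  refine ⟨x, ?_⟩
  have : ∑ j, max 0 (coordBound b z c j x) = max 0 (1 - c) := by
    rw [Finset.sum_eq_single i]
    · rw [hx, if_pos rfl]
    · intro j _ hj; rw [hx, if_neg hj, max_self]
    · simp
  rw [overlapRatio, this]
  rcases le_total c 1 with h | h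
  · rw [min_eq_right h, max_eq_right (by linarith)]; linarith
  · rw [min_eq_left h, max_eq_left (by linarith)]; linarith

/-- Coordinate bounds are affine in `x` and take any values with sum `1 - c`, so splitting `x`
amounts to splitting the vector of bounds. -/
theorem exists_combo_overlapRatio (b : AffineBasis ι ℝ E) (z : E) {c τ : ℝ} (hc : 0 < c)
    (hτ : τ ∈ Icc (0 : ℝ) 1) {x : E} (hx : τ * min 1 c ≤ overlapRatio b z c x) :
    ∃ x₁ x₀, min 1 c ≤ overlapRatio b z c x₁ ∧ 0 ≤ overlapRatio b z c x₀ ∧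
      x = τ • x₁ + (1 - τ) • x₀ := by
  rcases eq_or_lt_of_le hτ.2 with h1 | h1
  · subst h1
    rw [one_mul] at hx
    have hc1 : 0 < min 1 c := lt_min one_pos hc
    exact ⟨x, x, hx, hc1.le.trans hx, by simp⟩
  have h1' : 0 < 1 - τ := by linarith
  obtain ⟨β, hβ, hβ1, hβ0⟩ := exists_split_positive_parts (fun j => coordBound b z c j x)
    (sum_coordBound b z c x) hτ (by unfold overlapRatio at hx; linarith)
  obtain ⟨x₁, hx₁⟩ := exists_coordBound_eq b z β hβ
  set x₀ := (1 - τ)⁻¹ • (x - τ • x₁) with hx₀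
  have hx' : x = τ • x₁ + (1 - τ) • x₀ := by
    rw [hx₀, smul_inv_smul₀ h1'.ne', add_sub_cancel]
  refine ⟨x₁, x₀, ?_, ?_, hx'⟩
  · unfold overlapRatio
    simp only [hx₁]
    linarith
  · have h2 : ∀ j, (1 - τ) * max 0 (coordBound b z c j x₀) =
        max 0 (coordBound b z c j x - τ * β j) := by
      intro j
      rw [mul_max_of_nonneg _ _ h1'.le, mul_zero]
      conv_rhs => rw [hx', coordBound_combo b z c j x₁ x₀ (by ring), hx₁]
      congr 1; ring
    simp only [← h2, ← Finset.mul_sum] at hβ0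
    have h3 : ∑ j, max 0 (coordBound b z c j x₀) ≤ 1 := by
      by_contra hcon
      push Not at hcon
      nlinarith
    unfold overlapRatio; linarith

/-- The superlevel sets of the overlap ratio interpolate linearly. -/
theorem combo_superlevel_overlapRatio (b : AffineBasis ι ℝ E) (z : E) {c τ₁ τ₂ l₁ l₂ : ℝ}
    (hc : 0 < c) (hτ₁ : τ₁ ∈ Icc (0 : ℝ) 1) (hτ₂ : τ₂ ∈ Icc (0 : ℝ) 1) (hl₁ : 0 ≤ l₁)
    (hl₂ : 0 ≤ l₂) (hl : l₁ + l₂ = 1) :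
    l₁ • {x | τ₁ * min 1 c ≤ overlapRatio b z c x} + l₂ • {x | τ₂ * min 1 c ≤ overlapRatio b z c x}
      = {x | (l₁ * τ₁ + l₂ * τ₂) * min 1 c ≤ overlapRatio b z c x} := by
  apply Subset.antisymm
  · rintro _ ⟨_, ⟨x, hx, rfl⟩, _, ⟨y, hy, rfl⟩, rfl⟩
    simp only [mem_ofPred_eq] at hx hy ⊢
    refine le_trans ?_ (overlapRatio_combo_ge b z c x y hl₁ hl₂ hl)
    have h1 := mul_le_mul_of_nonneg_left hx hl₁
    have h2 := mul_le_mul_of_nonneg_left hy hl₂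
    linarith
  · intro x hx
    obtain ⟨h1, h1'⟩ := hτ₁
    obtain ⟨h2, h2'⟩ := hτ₂
    have hτ : l₁ * τ₁ + l₂ * τ₂ ∈ Icc (0 : ℝ) 1 := ⟨by positivity, by nlinarith⟩
    obtain ⟨x₁, x₀, hx₁, hx₀, rfl⟩ := exists_combo_overlapRatio b z hc hτ hx
    -- By concavity, the segment from `x₀` to `x₁` meets every level at the matching parameter; the
    -- points at `τ₁` and `τ₂` combine to the given one.
    have hmem : ∀ τ : ℝ, 0 ≤ τ → τ ≤ 1 →
        τ • x₁ + (1 - τ) • x₀ ∈ {x | τ * min 1 c ≤ overlapRatio b z c x} := by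
      intro τ h h'
      refine le_trans ?_ (overlapRatio_combo_ge b z c x₁ x₀ h (by linarith : 0 ≤ 1 - τ) (by ring))
      have h3 := mul_le_mul_of_nonneg_left hx₁ h
      have h4 := mul_nonneg (by linarith : 0 ≤ 1 - τ) hx₀
      linarith
    refine ⟨_, ⟨_, hmem τ₁ h1 h1', rfl⟩, _, ⟨_, hmem τ₂ h2 h2', rfl⟩, ?_⟩
    obtain rfl : l₂ = 1 - l₁ := by linarith
    simp only
    module

theorem overlap_nonempty_iff (hc : 0 < c) (hK : K = convexHull ℝ (range b))
    (hL : -L = {z} + c • K) (x : E) :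
    (overlap K L x).Nonempty ↔ 0 ≤ overlapRatio b z c x := by
  rw [overlap_eq_setOf_le_coord hc hK hL]
  constructor
  · rintro ⟨y, hy⟩
    have := Finset.sum_le_sum fun j (_ : j ∈ Finset.univ) => hy j
    rw [b.sum_coord_apply_eq_one] at this
    unfold overlapRatio; linarith
  · intro h
    rw [b.setOf_le_coord_eq _ (by unfold overlapRatio at h; linarith)]
    have := b.nonempty
    exact (singleton_nonempty _).add ((range_nonempty b).convexHull.smul_set)

theorem volume_overlap_eq [FiniteDimensional ℝ E] [MeasurableSpace E] [BorelSpace E] (hc : 0 < c)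
    (hK : K = convexHull ℝ (range b)) (hL : -L = {z} + c • K) {x : E}
    (hx : 0 ≤ overlapRatio b z c x) :
    volume (overlap K L x) =
      ENNReal.ofReal (overlapRatio b z c x ^ Module.finrank ℝ E) * volume K := by
  rw [overlap_eq_setOf_le_coord hc hK hL,
    b.setOf_le_coord_eq _ (by unfold overlapRatio at hx; linarith), singleton_add, image_add_left,
    measure_preimage_add, Measure.addHaar_smul, ← hK]
  change ENNReal.ofReal |overlapRatio b z c x ^ _| * _ = _
  rw [abs_of_nonneg (by positivity)]

end

/-! ### Convolution sets of simplices, and transport of simplices under homotheties. -/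

section

variable {n : ℕ} {K L : Set (EuclideanSpace ℝ (Fin n))} {ι : Type*} [Fintype ι]
  {b : AffineBasis ι ℝ (EuclideanSpace ℝ (Fin n))} {z : EuclideanSpace ℝ (Fin n)} {c : ℝ}

theorem maxOverlap_eq_of_simplex (hc : 0 < c) (hK : K = convexHull ℝ (range b))
    (hL : -L = {z} + c • K) :
    maxOverlap K L = ENNReal.ofReal (min 1 c ^ n) * volume K := by
  have hc1 : 0 ≤ min 1 c := (lt_min one_pos hc).le
  rw [maxOverlap_eq_iSup]
  refine le_antisymm (iSup_le fun x => ?_) ?_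
  · rcases lt_or_ge (overlapRatio b z c x) 0 with h | h
    · have : overlap K L x = ∅ := by
        by_contra hne
        exact absurd ((overlap_nonempty_iff hc hK hL x).1 (nonempty_iff_ne_empty.2 hne)) (not_le.2 h)
      rw [this, measure_empty]; exact zero_le
    · rw [volume_overlap_eq hc hK hL h, finrank_euclideanSpace_fin]
      gcongr
      exact overlapRatio_le b z c x
  · obtain ⟨x, hx⟩ := exists_le_overlapRatio b z (c := c)
    refine le_trans ?_ (le_iSup _ x)
    rw [volume_overlap_eq hc hK hL (hc1.trans hx), finrank_euclideanSpace_fin]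
    gcongr

/-- After cancelling the volume of `K`, both sides of the volume inequality are `n`-th powers. -/
theorem thetaConv_eq_superlevel (hn : n ≠ 0) (hc : 0 < c) (hK : K = convexHull ℝ (range b))
    (hL : -L = {z} + c • K) (hpos : volume K ≠ 0) (hfin : volume K ≠ ⊤) {θ : ℝ} (hθ : 0 ≤ θ) :
    thetaConv θ K L = {x | θ ^ (1 / (n : ℝ)) * min 1 c ≤ overlapRatio b z c x} := by
  have hc1 : 0 ≤ min 1 c := (lt_min one_pos hc).le
  have hτ0 : 0 ≤ θ ^ (1 / (n : ℝ)) := by positivity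
  have hadd : ∀ x, x ∈ K + L ↔ 0 ≤ overlapRatio b z c x := fun x => by
    rw [← overlap_nonempty_iff hc hK hL]
    refine ⟨?_, mem_add_of_overlap_nonempty⟩
    rintro ⟨k, hk, l, hl, rfl⟩
    exact ⟨k, hk, by simpa using hl⟩
  ext x
  rw [mem_thetaConv, hadd, maxOverlap_eq_of_simplex hc hK hL, mem_ofPred_eq]
  have key : 0 ≤ overlapRatio b z c x →
      (ENNReal.ofReal θ * (ENNReal.ofReal (min 1 c ^ n) * volume K) ≤ volume (overlap K L x) ↔
        θ ^ (1 / (n : ℝ)) * min 1 c ≤ overlapRatio b z c x) := by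
    intro hx
    rw [volume_overlap_eq hc hK hL hx, finrank_euclideanSpace_fin, ← mul_assoc,
      ENNReal.mul_le_mul_iff_left hpos hfin, ← ENNReal.ofReal_mul hθ,
      ENNReal.ofReal_le_ofReal_iff (by positivity)]
    nth_rewrite 1 [← Real.rpow_inv_natCast_pow hθ hn]
    rw [← one_div, ← mul_pow, pow_le_pow_iff_left₀ (by positivity) hx hn]
  exact ⟨fun h => (key h.1).1 h.2, fun h =>
    ⟨(by positivity : 0 ≤ _ * min 1 c).trans h, (key ((by positivity : 0 ≤ _ * min 1 c).trans h)).2 h⟩⟩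

theorem combo_thetaConv_of_simplex (hn : n ≠ 0) (hKs : IsFullSimplex K)
    (hKL : AreHomothetic K (-L)) {θ₁ θ₂ l₁ l₂ θ : ℝ} (hθ₁ : θ₁ ∈ Icc (0 : ℝ) 1)
    (hθ₂ : θ₂ ∈ Icc (0 : ℝ) 1) (hl₁ : 0 ≤ l₁) (hl₂ : 0 ≤ l₂) (hl : l₁ + l₂ = 1) (hθ : 0 ≤ θ)
    (h : θ ^ (1 / (n : ℝ)) = l₁ * θ₁ ^ (1 / (n : ℝ)) + l₂ * θ₂ ^ (1 / (n : ℝ)))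
    (hpos : volume K ≠ 0) (hfin : volume K ≠ ⊤) :
    l₁ • thetaConv θ₁ K L + l₂ • thetaConv θ₂ K L = thetaConv θ K L := by
  obtain ⟨s, hs⟩ := hKs
  obtain ⟨z, c, hc, hL⟩ := hKL
  let b : AffineBasis (Fin (n + 1)) ℝ (EuclideanSpace ℝ (Fin n)) := ⟨s.points, s.independent, by
    rw [s.independent.affineSpan_eq_top_iff_card_eq_finrank_add_one, Fintype.card_fin,
      finrank_euclideanSpace_fin]⟩
  have hK : K = convexHull ℝ (range b) := hs
  have hrpow : ∀ θ ∈ Icc (0 : ℝ) 1, θ ^ (1 / (n : ℝ)) ∈ Icc (0 : ℝ) 1 := fun θ hθ =>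
    ⟨Real.rpow_nonneg hθ.1 _, Real.rpow_le_one hθ.1 hθ.2 (by positivity)⟩
  rw [thetaConv_eq_superlevel hn hc hK hL hpos hfin hθ₁.1,
    thetaConv_eq_superlevel hn hc hK hL hpos hfin hθ₂.1,
    thetaConv_eq_superlevel hn hc hK hL hpos hfin hθ, h]
  exact combo_superlevel_overlapRatio b z hc (hrpow _ hθ₁) (hrpow _ hθ₂) hl₁ hl₂ hl

theorem isFullSimplex_of_affineBasis
    (b : AffineBasis (Fin (Module.finrank ℝ (EuclideanSpace ℝ (Fin n)) + 1)) ℝ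
      (EuclideanSpace ℝ (Fin n))) : IsFullSimplex (convexHull ℝ (range b)) := by
  have e : Fin (n + 1) ≃ Fin (Module.finrank ℝ (EuclideanSpace ℝ (Fin n)) + 1) :=
    finCongr (by rw [finrank_euclideanSpace_fin])
  exact ⟨⟨b ∘ e, b.ind.comp_embedding e.toEmbedding⟩, by
    change _ = convexHull ℝ (range (b ∘ e)); rw [EquivLike.range_comp]⟩

theorem IsFullSimplex.image {A : Set (EuclideanSpace ℝ (Fin n))} (hA : IsFullSimplex A)
    {f : EuclideanSpace ℝ (Fin n) →ᵃ[ℝ] EuclideanSpace ℝ (Fin n)} (hf : Function.Injective f) :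
    IsFullSimplex (f '' A) := by
  obtain ⟨s, rfl⟩ := hA
  refine ⟨s.map f hf, ?_⟩
  rw [AffineMap.image_convexHull, ← range_comp]
  rfl

theorem IsFullSimplex.neg {A : Set (EuclideanSpace ℝ (Fin n))} (hA : IsFullSimplex A) :
    IsFullSimplex (-A) := by
  have := hA.image (f := (-(AffineMap.id ℝ (EuclideanSpace ℝ (Fin n)))))
    (fun x y h => by simpa using h)
  rw [← image_neg_eq_neg]
  exact this

theorem IsFullSimplex.of_forall_mem_iff {A B : Set (EuclideanSpace ℝ (Fin n))}
    (hA : IsFullSimplex A) {z : EuclideanSpace ℝ (Fin n)} {s : ℝ} (hs : 0 < s)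
    (h : ∀ y, y ∈ A ↔ z - s • y ∈ B) : IsFullSimplex B := by
  have := hA.image (f := AffineMap.const ℝ _ z - s • AffineMap.id ℝ (EuclideanSpace ℝ (Fin n)))
    (fun x y h => by simpa [hs.ne'] using h)
  convert this using 1
  ext y
  constructor
  · intro hy
    refine ⟨s⁻¹ • (z - y), (h _).2 ?_, ?_⟩
    · rwa [smul_inv_smul₀ hs.ne', sub_sub_cancel]
    · simp [smul_inv_smul₀ hs.ne']
  · rintro ⟨x, hx, rfl⟩
    simpa using (h x).1 hx

theorem areHomothetic_of_forall_mem_iff {A B : Set (EuclideanSpace ℝ (Fin n))}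
    {z : EuclideanSpace ℝ (Fin n)} {s : ℝ} (hs : 0 < s) (h : ∀ y, y ∈ A ↔ z - s • y ∈ B) :
    AreHomothetic A (-B) ∧ AreHomothetic B (-A) := by
  refine ⟨⟨-z, s, hs, ?_⟩, ⟨-(s⁻¹ • z), s⁻¹, inv_pos.2 hs, ?_⟩⟩
  · ext y
    rw [singleton_add, mem_image, Set.mem_neg]
    constructor
    · intro hy
      refine ⟨_, ⟨s⁻¹ • (z + y), (h _).2 ?_, rfl⟩, ?_⟩
      · rw [smul_inv_smul₀ hs.ne', sub_add_cancel_left]; exact hy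
      · simp only; rw [smul_inv_smul₀ hs.ne', neg_add_cancel_left]
    · rintro ⟨_, ⟨x, hx, rfl⟩, rfl⟩
      have := (h x).1 hx
      simp only
      rwa [neg_add_rev, neg_neg, neg_add_eq_sub]
  · ext y
    rw [singleton_add, mem_image, Set.mem_neg, h, smul_neg, sub_neg_eq_add]
    constructor
    · intro hy
      refine ⟨_, ⟨_, hy, rfl⟩, ?_⟩
      simp only
      rw [smul_add, inv_smul_smul₀ hs.ne', neg_add_cancel_left]
    · rintro ⟨_, ⟨x, hx, rfl⟩, rfl⟩
      simp only
      rwa [smul_add, smul_neg, smul_inv_smul₀ hs.ne', smul_inv_smul₀ hs.ne', add_neg_cancel_left]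

end

/-! ### The equivalence. -/

theorem mainTheorem5 (n : ℕ) (hn : 1 ≤ n)
    (K L : ConvexBody (EuclideanSpace ℝ (Fin n)))
    (hK : (interior (K : Set (EuclideanSpace ℝ (Fin n)))).Nonempty)
    (hL : (interior (L : Set (EuclideanSpace ℝ (Fin n)))).Nonempty) :
    List.TFAE [
      ∀ θ₁ ∈ Set.Icc (0 : ℝ) 1, ∀ θ₂ ∈ Set.Icc (0 : ℝ) 1,
        ∀ l₁ ∈ Set.Icc (0 : ℝ) 1, ∀ l₂ ∈ Set.Icc (0 : ℝ) 1, l₁ + l₂ = 1 →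
        ∀ θ ∈ Set.Icc (0 : ℝ) 1,
          θ ^ (1 / (n : ℝ)) = l₁ * θ₁ ^ (1 / (n : ℝ)) + l₂ * θ₂ ^ (1 / (n : ℝ)) →
          l₁ • thetaConv θ₁ (K : Set (EuclideanSpace ℝ (Fin n))) L + l₂ • thetaConv θ₂ K L
            = thetaConv θ K L,
      ∀ θ ∈ Set.Icc (0 : ℝ) 1,
        θ ^ (1 / (n : ℝ)) • thetaConv 1 (K : Set (EuclideanSpace ℝ (Fin n))) L
            + (1 - θ ^ (1 / (n : ℝ))) •
              ((K : Set (EuclideanSpace ℝ (Fin n))) + (L : Set (EuclideanSpace ℝ (Fin n))))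
          = thetaConv θ K L,
      IsFullSimplex (K : Set (EuclideanSpace ℝ (Fin n))) ∧
        IsFullSimplex (-(L : Set (EuclideanSpace ℝ (Fin n)))) ∧
        AreHomothetic (K : Set (EuclideanSpace ℝ (Fin n)))
          (-(L : Set (EuclideanSpace ℝ (Fin n))))] := by
  have hn0 : n ≠ 0 := by omega
  have hn' : 1 / (n : ℝ) ≠ 0 := by positivity
  tfae_have 1 → 2 := by
    intro h θ hθ
    have hτ0 : 0 ≤ θ ^ (1 / (n : ℝ)) := Real.rpow_nonneg hθ.1 _
    have hτ1 : θ ^ (1 / (n : ℝ)) ≤ 1 := Real.rpow_le_one hθ.1 hθ.2 (by positivity)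
    have h0 : thetaConv 0 (K : Set (EuclideanSpace ℝ (Fin n))) L =
        (K : Set (EuclideanSpace ℝ (Fin n))) + (L : Set (EuclideanSpace ℝ (Fin n))) := by
      ext x; rw [mem_thetaConv]; simp
    rw [← h0]
    -- Levels `1` and `0` with weights `θ ^ (1 / n)` and its complement; level `0` is `K + L`.
    exact h 1 (by simp) 0 (by simp) _ ⟨hτ0, hτ1⟩ _ ⟨by linarith, by linarith⟩ (by ring) θ hθ
      (by rw [Real.one_rpow, Real.zero_rpow hn']; ring)
  tfae_have 2 → 3 := by
    intro h
    have hnt : Nontrivial (EuclideanSpace ℝ (Fin n)) := by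
      apply Module.nontrivial_of_finrank_pos (R := ℝ)
      rw [finrank_euclideanSpace_fin]; omega
    have hcon := hasConicalOverlaps_of_thetaConv hn K.convex L.convex K.isCompact L.isCompact
      hK hL h
    obtain ⟨x, -, hx | hx⟩ :=
      hcon.exists_subset K.convex L.convex K.isCompact L.isCompact hK hL
    · obtain ⟨b, hb, z, s, hs, hz⟩ := hcon.exists_simplex_of_subset K.convex L.convex K.isCompact
        L.isCompact hK hL hx
      have hLs : IsFullSimplex (L : Set (EuclideanSpace ℝ (Fin n))) :=
        hb ▸ isFullSimplex_of_affineBasis b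
      exact ⟨hLs.of_forall_mem_iff hs hz, hLs.neg, (areHomothetic_of_forall_mem_iff hs hz).2⟩
    · obtain ⟨b, hb, z, s, hs, hz⟩ := hcon.swap.exists_simplex_of_subset L.convex K.convex
        L.isCompact K.isCompact hL hK hx
      have hKs : IsFullSimplex (K : Set (EuclideanSpace ℝ (Fin n))) :=
        hb ▸ isFullSimplex_of_affineBasis b
      exact ⟨hKs, (hKs.of_forall_mem_iff hs hz).neg, (areHomothetic_of_forall_mem_iff hs hz).1⟩
  tfae_have 3 → 1 := by
    rintro ⟨hKs, -, hKL⟩ θ₁ hθ₁ θ₂ hθ₂ l₁ hl₁ l₂ hl₂ hl θ hθ h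
    have hpos : MeasureTheory.volume (K : Set (EuclideanSpace ℝ (Fin n))) ≠ 0 :=
      (MeasureTheory.Measure.measure_pos_of_nonempty_interior _ hK).ne'
    exact combo_thetaConv_of_simplex hn0 hKs hKL hθ₁ hθ₂ hl₁.1 hl₂.1 hl hθ.1 h hpos
      K.isCompact.measure_lt_top.ne
  tfae_finish
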